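/- Let $n\ge 2$, let $((z,w))=-z_0\bar w_0+\sum_{k=1}^n z_k\bar w_k$ on $\mathbb C_1^{n+1}=\mathbb C^{n+1}$, let $\pi_-:H_1^{2n+1}=\{((w,w))=-1\}\to\mathbb{CH}^n=H_1^{2n+1}/S^1$ be the Hopf fibration onto complex hyperbolic space with the metric of constant holomorphic sectional curvature $-4$, for which the differential of $\pi_-$ is isometric on the vectors horizontal (orthogonal to the fibres), and let $$M_V=\{(u_-,u_+)\in(\mathbb C_1^{n+1})^2:\ ((u_-,u_-))=-1,\ ((u_+,u_+))=1,\ ((u_-,u_+))=0\}.$$ For $s\in\{+,-,0\}$ and $t\in\mathbb R$ put $$E_+(t)=\begin{pmatrix}e^{it}&0\\0&e^{-it}\end{pmatrix},\quad E_-(t)=\begin{pmatrix}\cosh t&\sinh t\\ \sinh t&\cosh t\end{pmatrix},\quad E_0(t)=\begin{pmatrix}1+it&t\\t&1-it\end{pmatrix},$$ and let $M_Z^s$ be the quotient of $M_V$ by $(u_-,u_+)\sim e^{i\theta}(u_-,u_+)E_s(t)$, $\theta,t\in\mathbb R$. For $(u_-,u_+)\in M_V$ and $r,t\in\mathbb R$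 put $$\gamma_r^+(t)=(u_-\ u_+)\,E_+(t)\begin{pmatrix}\cosh r\\ \sinh r\end{pmatrix},\qquad \gamma_r^s(t)=(u_-\ u_+)\,E_s(t)\begin{pmatrix}\cosh r\\ i\sinh r\end{pmatrix}\quad(s=-,0).$$ Let $M_G=\mathbb G_{1,1}(\mathbb C_1^{n+1})$ be the set of planes $P=\operatorname{span}_{\mathbb C}\{u_-,u_+\}$, $(u_-,u_+)\in M_V$. Its tangent space at $P$ is $\operatorname{Hom}_{\mathbb C}(P,P^\perp)\cong\{u_-,u_+\}^\perp\times\{u_-,u_+\}^\perp$, $X\mapsto(X_-,X_+)=(Xu_-,Xu_+)$, and its para-quaternionic structure $Q$ is spanned over $\mathbb R$ at $P$ by $I_1(X_-,X_+)=(iX_-,-iX_+)$, $I_2(X_-,X_+)=(X_+,X_-)$, $I_3(X_-,X_+)=(iX_+,-iX_-)$. For each $s$ the following hold. 1. Sending the class of $(u_-,u_+)$ to the plane $\operatorname{span}_{\mathbb C}\{u_-,u_+\}$ together with $I_1$ (for $s=+$), $I_2$ (for $s=-$), $I_1+I_2$ (for $s=0$) is a well-defined bijection from $M_Z^s$ onto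 the bundle over $M_G$ of all $I=aI_1+bI_2+cI_3\in Q$ with $I^2=-1$, $a>0$ (for $s=+$), with $I^2=1$ (for $s=-$), with $I^2=0$, $a>0$ (for $s=0$), respectively. 2. Sending the class of $(u_-,u_+)$ to the family $r\mapsto\pi_-(\gamma_r^s(\mathbb R))$ of subsets of $\mathbb{CH}^n$, indexed by $r\in\mathbb R$, is a well-defined bijection from $M_Z^s$ onto the set of all such families. 3. For every $(u_-,u_+)\in M_V$ the curves $\pi_-\circ\gamma_r^s$, $r\in\mathbb R$, are parallel: for each $t$ the curve $r\mapsto\pi_-(\gamma_r^s(t))$ is a unit speed geodesic of $\mathbb{CH}^n$ that is orthogonal to all of them. They all lie in the complex hyperbolic line $\mathbb{CH}^1=\pi_-(H_1^{2n+1}\cap\operatorname{span}_{\mathbb C}\{u_-,u_+\})$, which is totally geodesic in $\mathbb{CH}^n$. Each of them (with $r\neq0$ if $s=+$; for $s=+$, $r=0$ it is a point) is a smooth regular curve of constant curvature $\kappa$, where $\kappa>2$ for $s=+$, $0\le\kappa<2$ for $s=-$ and $\kappa=2$ for $s=0$; here $\kappa=|(\nabla_{\dot c}\dot c)^\perp|/|\dot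 c|^2$ is the unsigned geodesic curvature of a curve $c$ in $\mathbb{CH}^n$. 4. Conversely, let $\kappa>2$ (for $s=+$), $0\le\kappa<2$ (for $s=-$), $\kappa=2$ (for $s=0$). Every smooth unit speed curve $c:\mathbb R\to\mathbb{CH}^n$ of constant curvature $\kappa$ that lies in a complex hyperbolic line $\pi_-(H_1^{2n+1}\cap P)$, $P\in M_G$, is of the form $c(t)=\pi_-(\gamma_r^s(at))$ for some $(u_-,u_+)\in M_V$ with $\operatorname{span}_{\mathbb C}\{u_-,u_+\}=P$, some $r\in\mathbb R$ (with $r\ne0$ if $s=+$) and some $a\in\mathbb R\setminus\{0\}$. -/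

import Mathlib

open scoped ComplexConjugate ContDiff Matrix

noncomputable section

namespace CHTwistor

/-! ### The Hermitian form, anti de Sitter space and complex hyperbolic space -/

/-- The Hermitian form `((z, w)) = -z₀ w̄₀ + ∑ zⱼ w̄ⱼ` of signature `(1, n)` on `ℂ^{n+1}`. -/
def herm {n : ℕ} (z w : Fin (n + 1) → ℂ) : ℂ :=
  -(z 0 * conj (w 0)) + ∑ j : Fin n, z j.succ * conj (w j.succ)

theorem herm_add_left {n : ℕ} (x y w : Fin (n + 1) → ℂ) :
    herm (x + y) w = herm x w + herm y w := by
  simp only [herm, Pi.add_apply, add_mul, Finset.sum_add_distrib]; ring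

theorem herm_smul_left {n : ℕ} (a : ℂ) (x w : Fin (n + 1) → ℂ) :
    herm (a • x) w = a * herm x w := by
  simp only [herm, Pi.smul_apply, smul_eq_mul, mul_add, Finset.mul_sum]
  congr 1
  · ring
  · exact Finset.sum_congr rfl fun j _ => by ring

theorem herm_conj {n : ℕ} (x w : Fin (n + 1) → ℂ) : conj (herm x w) = herm w x := by
  simp only [herm, map_add, map_neg, map_mul, map_sum, Complex.conj_conj]
  congr 1
  · ring
  · exact Finset.sum_congr rfl fun j _ => by ring

theorem herm_add_right {n : ℕ} (x y w : Fin (n + 1) → ℂ) :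
    herm w (x + y) = herm w x + herm w y := by
  rw [← herm_conj, herm_add_left, map_add, herm_conj, herm_conj]

theorem herm_smul_right {n : ℕ} (a : ℂ) (x w : Fin (n + 1) → ℂ) :
    herm w (a • x) = conj a * herm w x := by
  rw [← herm_conj, herm_smul_left, map_mul, herm_conj]

/-- The anti de Sitter space `H₁^{2n+1} = {w : ((w, w)) = -1}`. -/
def AntiDeSitter (n : ℕ) : Type := {w : Fin (n + 1) → ℂ // herm w w = -1}

/-- Two points of `H₁^{2n+1}` are equivalent if they differ by a factor `e^{iθ}`. -/
instance hopfSetoid (n : ℕ) : Setoid (AntiDeSitter n) where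
  r w w' := ∃ θ : ℝ, w'.1 = Complex.exp (θ * Complex.I) • w.1
  iseqv :=
    { refl := fun w => ⟨0, by simp⟩
      symm := by
        rintro w w' ⟨θ, h⟩
        refine ⟨-θ, ?_⟩
        rw [h, smul_smul, ← Complex.exp_add]
        simp
      trans := by
        rintro w w' w'' ⟨θ, h⟩ ⟨θ', h'⟩
        refine ⟨θ' + θ, ?_⟩
        rw [h', h, smul_smul, ← Complex.exp_add, Complex.ofReal_add, add_mul] }

/-- Complex hyperbolic space `CHⁿ = H₁^{2n+1} / S¹`. -/
def CH (n : ℕ) : Type := Quotient (hopfSetoid n)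

/-- The Hopf fibration `π₋ : H₁^{2n+1} → CHⁿ`. -/
def hopf {n : ℕ} (w : AntiDeSitter n) : CH n := Quotient.mk (hopfSetoid n) w

/-- The global holomorphic chart `[w] ↦ (w₁/w₀, …, wₙ/w₀)` of `CHⁿ`, onto the unit ball of `ℂⁿ`.
It defines the smooth structure, and the complex structure is multiplication by `i` in it. -/
def chart {n : ℕ} (p : CH n) : Fin n → ℂ :=
  Quotient.lift (s := hopfSetoid n) (fun w j => w.1 j.succ / w.1 0)
    (by
      rintro w w' ⟨θ, h⟩
      funext j
      simp only [h, Pi.smul_apply, smul_eq_mul]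
      rw [mul_div_mul_left _ _ (Complex.exp_ne_zero _)]) p

/-- `1 - |z|²` for `z` in `ℂⁿ`. -/
def defect {n : ℕ} (z : Fin n → ℂ) : ℝ := 1 - ∑ j, Complex.normSq (z j)

/-- The horizontal lift `X'`, with `((X', w)) = 0`, of the tangent vector with coordinates `X` at
the point with coordinates `z`, taken at the point `w = (1, z) / √(1 - |z|²)` of the fibre. -/
def horLift {n : ℕ} (z X : Fin n → ℂ) : Fin (n + 1) → ℂ :=
  ((Real.sqrt (defect z))⁻¹ : ℂ) •
    ((Fin.cons 0 X : Fin (n + 1) → ℂ) +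
      ((∑ j, X j * conj (z j)) / (defect z : ℂ)) • (Fin.cons 1 z : Fin (n + 1) → ℂ))

/-- The Riemannian metric `⟨X, Y⟩ = Re ((X', Y'))` of `CHⁿ` (holomorphic sectional curvature `-4`),
in the chart. -/
def metric {n : ℕ} (z X Y : Fin n → ℂ) : ℝ := (herm (horLift z X) (horLift z Y)).re

/-! ### Curves in `CHⁿ` and the Levi-Civita connection -/

/-- A curve in `CHⁿ` is smooth. -/
def IsSmoothCurve {n : ℕ} (c : ℝ → CH n) : Prop := ContDiff ℝ ∞ fun t => chart (c t)

/-- The velocity of a curve, in the chart. -/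
def velocity {n : ℕ} (c : ℝ → CH n) (t : ℝ) : Fin n → ℂ := deriv (fun τ => chart (c τ)) t

/-- The derivative in the direction `W` of the metric coefficient `⟨X, Y⟩` of constant fields. -/
def metricDeriv {n : ℕ} (z W X Y : Fin n → ℂ) : ℝ :=
  deriv (fun τ : ℝ => metric (z + τ • W) X Y) 0

/-- The Christoffel symbols of the first kind `⟨∇_X Y, Z⟩` of constant fields (Koszul formula). -/
def christoffel {n : ℕ} (z X Y Z : Fin n → ℂ) : ℝ :=
  (metricDeriv z X Y Z + metricDeriv z Y X Z - metricDeriv z Z X Y) / 2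

/-- `V` is (in the chart) the covariant derivative `∇_ċ ċ` at time `t` of the velocity of `c`,
for the Levi-Civita connection of `CHⁿ`. -/
def IsAcceleration {n : ℕ} (c : ℝ → CH n) (t : ℝ) (V : Fin n → ℂ) : Prop :=
  ∀ Z : Fin n → ℂ, metric (chart (c t)) V Z =
    metric (chart (c t)) (deriv (velocity c) t) Z +
      christoffel (chart (c t)) (velocity c t) (velocity c t) Z

/-- A (complete, affinely parametrized) geodesic of `CHⁿ`. -/
def IsGeodesic {n : ℕ} (c : ℝ → CH n) : Prop :=
  IsSmoothCurve c ∧ ∀ t, IsAcceleration c t 0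

/-- The squared speed of a curve. -/
def speedSq {n : ℕ} (c : ℝ → CH n) (t : ℝ) : ℝ :=
  metric (chart (c t)) (velocity c t) (velocity c t)

/-- The part of `V` orthogonal to the velocity of `c` at time `t`. -/
def normalPart {n : ℕ} (c : ℝ → CH n) (t : ℝ) (V : Fin n → ℂ) : Fin n → ℂ :=
  V - (metric (chart (c t)) V (velocity c t) / speedSq c t) • velocity c t

/-- At time `t` the curve `c` is regular and its (geodesic) curvature `|(∇_ċ ċ)^⊥| / |ċ|²` is
`κ`. -/
def HasCurvature {n : ℕ} (c : ℝ → CH n) (t κ : ℝ) : Prop :=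
  velocity c t ≠ 0 ∧ ∃ V : Fin n → ℂ, IsAcceleration c t V ∧
    κ = Real.sqrt (metric (chart (c t)) (normalPart c t V) (normalPart c t V)) / speedSq c t

/-- A subset `S` of `CHⁿ` is totally geodesic: a geodesic of `CHⁿ` that at some time is in `S`
and tangent to `S` (it has the velocity of a smooth curve in `S`) stays in `S`. -/
def IsTotallyGeodesic {n : ℕ} (S : Set (CH n)) : Prop :=
  ∀ c : ℝ → CH n, IsGeodesic c → ∀ t₀ : ℝ, c t₀ ∈ S →
    (∃ b : ℝ → CH n, IsSmoothCurve b ∧ (∀ t, b t ∈ S) ∧ b 0 = c t₀ ∧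
      velocity b 0 = velocity c t₀) →
    ∀ t, c t ∈ S

/-- `r ↦ Γ r` is a family of parallel curves (with signed distance `r`): for every `t` the curve
`r ↦ Γ r t` is a geodesic of unit speed, orthogonal to all the curves `Γ r`. -/
def IsParallelFamily {n : ℕ} (Γ : ℝ → ℝ → CH n) : Prop :=
  (∀ t, IsGeodesic (fun r => Γ r t) ∧ ∀ r, speedSq (fun ρ => Γ ρ t) r = 1) ∧
    ∀ r t, metric (chart (Γ r t)) (velocity (fun ρ => Γ ρ t) r) (velocity (Γ r) t) = 0

/-! ### The Stiefel manifold and the Grassmannian -/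

/-- The Stiefel manifold `M_V = V_{1,1}(ℂ₁^{n+1})`. -/
structure Stiefel (n : ℕ) where
  neg : Fin (n + 1) → ℂ
  pos : Fin (n + 1) → ℂ
  herm_neg : herm neg neg = -1
  herm_pos : herm pos pos = 1
  herm_neg_pos : herm neg pos = 0

theorem Stiefel.herm_pos_neg {n : ℕ} (u : Stiefel n) : herm u.pos u.neg = 0 := by
  rw [← herm_conj, u.herm_neg_pos, map_zero]

/-- The complex plane `π^{VG}(u₋, u₊)` spanned by `u₋` and `u₊`; the Grassmannian
`G_{1,1}(ℂ₁^{n+1})` is the set of these planes. -/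
def plane {n : ℕ} (u : Stiefel n) : Submodule ℂ (Fin (n + 1) → ℂ) :=
  Submodule.span ℂ {u.neg, u.pos}

/-- The complex hyperbolic line `CH¹ = π₋(H₁^{2n+1} ∩ P)` of a plane `P` in the Grassmannian. -/
def hyperbolicLine {n : ℕ} (P : Submodule ℂ (Fin (n + 1) → ℂ)) : Set (CH n) :=
  {p | ∃ w : AntiDeSitter n, w.1 ∈ P ∧ hopf w = p}

/-- The orthogonal complement of `P` for the Hermitian form. -/
def perp {n : ℕ} (P : Submodule ℂ (Fin (n + 1) → ℂ)) : Submodule ℂ (Fin (n + 1) → ℂ) where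
  carrier := {x | ∀ y ∈ P, herm x y = 0}
  add_mem' := fun {a b} ha hb y hy => by rw [herm_add_left, ha y hy, hb y hy, add_zero]
  zero_mem' := fun y _ => by simp [herm]
  smul_mem' := fun a x hx y hy => by rw [herm_smul_left, hx y hy, mul_zero]

/-- The tangent space `Hom_ℂ(P, P^⊥)` of the Grassmannian at `P`. For `P = π^{VG}(u₋, u₊)` it is
`{u₋, u₊}^⊥ × {u₋, u₊}^⊥`, where `X` corresponds to `(X₋, X₊) = (X u₋, X u₊)`. -/
abbrev Tangent {n : ℕ} (P : Submodule ℂ (Fin (n + 1) → ℂ)) : Type := P →ₗ[ℂ] perp P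

/-- The total space of the bundle of endomorphisms of the tangent spaces. -/
abbrev EndBundle (n : ℕ) : Type :=
  Σ P : Submodule ℂ (Fin (n + 1) → ℂ), Module.End ℝ (Tangent P)

theorem frame_mem {n : ℕ} (u : Stiefel n) (a b : ℂ) : a • u.neg + b • u.pos ∈ plane u :=
  Submodule.mem_span_pair.2 ⟨a, b, rfl⟩

/-- The endomorphism of the plane with matrix `A` in the basis `(u₋, u₊)`; the coordinates of `x`
in this basis are `-((x, u₋))` and `((x, u₊))`. -/
def frameEnd {n : ℕ} (u : Stiefel n) (A : Matrix (Fin 2) (Fin 2) ℂ) : Module.End ℂ (plane u) where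
  toFun x := ⟨(A 0 0 * -herm x.1 u.neg + A 0 1 * herm x.1 u.pos) • u.neg +
      (A 1 0 * -herm x.1 u.neg + A 1 1 * herm x.1 u.pos) • u.pos, frame_mem u _ _⟩
  map_add' x y := by
    ext1
    simp only [Submodule.coe_add, herm_add_left]
    module
  map_smul' a x := by
    ext1
    simp only [Submodule.coe_smul, herm_smul_left, RingHom.id_apply]
    module

/-- The endomorphism `(X₋, X₊) ↦ (X₋, X₊) A` of the tangent space. -/
def rightMul {n : ℕ} (u : Stiefel n) (A : Matrix (Fin 2) (Fin 2) ℂ) :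
    Module.End ℝ (Tangent (plane u)) where
  toFun X := X ∘ₗ frameEnd u A
  map_add' _ _ := LinearMap.add_comp _ _ _
  map_smul' _ _ := LinearMap.smul_comp _ _ _

/-- `I₁ (X₋, X₊) = (i X₋, -i X₊)`. -/
def I₁ {n : ℕ} (u : Stiefel n) : Module.End ℝ (Tangent (plane u)) :=
  rightMul u !![Complex.I, 0; 0, -Complex.I]

/-- `I₂ (X₋, X₊) = (X₊, X₋)`. -/
def I₂ {n : ℕ} (u : Stiefel n) : Module.End ℝ (Tangent (plane u)) :=
  rightMul u !![0, 1; 1, 0]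

/-- `I₃ (X₋, X₊) = (i X₊, -i X₋)`. -/
def I₃ {n : ℕ} (u : Stiefel n) : Module.End ℝ (Tangent (plane u)) :=
  rightMul u !![0, -Complex.I; Complex.I, 0]

/-- The element `a I₁ + b I₂ + c I₃` of the para-quaternionic structure `Q` of the Grassmannian. -/
def pqEnd {n : ℕ} (u : Stiefel n) (a b c : ℝ) : Module.End ℝ (Tangent (plane u)) :=
  a • I₁ u + b • I₂ u + c • I₃ u

/-! ### The twistor spaces -/

/-- The index `s ∈ {+, -, 0}`. -/
inductive Kind where
  | plus
  | minus
  | zero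

/-- The one-parameter subgroups of `SU(1,1)` acting on the Stiefel manifold from the right. -/
def oneParam : Kind → ℝ → Matrix (Fin 2) (Fin 2) ℂ
  | .plus, t => !![Complex.exp (t * Complex.I), 0; 0, Complex.exp (-(t * Complex.I))]
  | .minus, t => !![(Real.cosh t : ℂ), (Real.sinh t : ℂ); (Real.sinh t : ℂ), (Real.cosh t : ℂ)]
  | .zero, t => !![1 + t * Complex.I, (t : ℂ); (t : ℂ), 1 - t * Complex.I]

theorem oneParam_zero (s : Kind) : oneParam s 0 = 1 := by
  ext i j
  cases s <;> fin_cases i <;> fin_cases j <;> simp [oneParam]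

theorem oneParam_add (s : Kind) (t t' : ℝ) :
    oneParam s (t + t') = oneParam s t * oneParam s t' := by
  ext i j
  cases s <;> fin_cases i <;> fin_cases j <;>
    simp [oneParam, Matrix.mul_apply, Fin.sum_univ_two, add_mul, Complex.exp_add, Complex.cosh_add,
      Complex.sinh_add]
  all_goals (ring_nf; try (rw [Complex.I_sq]; ring))

/-- The first vector of `(u₋, u₊) h`. -/
def mulNeg {n : ℕ} (u : Stiefel n) (h : Matrix (Fin 2) (Fin 2) ℂ) : Fin (n + 1) → ℂ :=
  h 0 0 • u.neg + h 1 0 • u.pos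

/-- The second vector of `(u₋, u₊) h`. -/
def mulPos {n : ℕ} (u : Stiefel n) (h : Matrix (Fin 2) (Fin 2) ℂ) : Fin (n + 1) → ℂ :=
  h 0 1 • u.neg + h 1 1 • u.pos

/-- The orbits in `M_V` of the commuting actions of `e^{iθ}` and of the one-parameter group of
kind `s`. -/
@[reducible] def twistorSetoid (n : ℕ) (s : Kind) : Setoid (Stiefel n) where
  r u v := ∃ θ t : ℝ, v.neg = Complex.exp (θ * Complex.I) • mulNeg u (oneParam s t) ∧
    v.pos = Complex.exp (θ * Complex.I) • mulPos u (oneParam s t)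
  iseqv :=
    { refl := fun u => ⟨0, 0, by simp [oneParam_zero, mulNeg, mulPos]⟩
      symm := by
        rintro u v ⟨θ, t, h₁, h₂⟩
        refine ⟨-θ, -t, ?_⟩
        have h : oneParam s t * oneParam s (-t) = 1 := by
          rw [← oneParam_add, add_neg_cancel, oneParam_zero]
        have e : Complex.exp (((-θ : ℝ) : ℂ) * Complex.I) * Complex.exp (θ * Complex.I) = 1 := by
          rw [← Complex.exp_add]; simp
        have h00 := congrFun (congrFun h 0) 0
        have h01 := congrFun (congrFun h 0) 1
        have h10 := congrFun (congrFun h 1) 0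
        have h11 := congrFun (congrFun h 1) 1
        simp only [Matrix.mul_apply, Fin.sum_univ_two, Matrix.one_apply_eq, ne_eq, zero_ne_one,
          one_ne_zero, not_false_eq_true, Matrix.one_apply_ne] at h00 h01 h10 h11
        have key : ∀ E E' a b c d p q : ℂ, (E * E' * (a * p + b * q)) • u.neg +
            (E * E' * (c * p + d * q)) • u.pos =
            E • (p • E' • (a • u.neg + c • u.pos) + q • E' • (b • u.neg + d • u.pos)) := by
          intros; module
        constructor
        · rw [mulNeg, h₁, h₂, mulNeg, mulPos, ← key, h00, h10, e]
          simp
        · rw [mulPos, h₁, h₂, mulNeg, mulPos, ← key, h01, h11, e]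
          simp
      trans := by
        rintro u v w ⟨θ, t, h₁, h₂⟩ ⟨θ', t', h₁', h₂'⟩
        refine ⟨θ + θ', t + t', ?_⟩
        rw [h₁', h₂', oneParam_add, Complex.ofReal_add, add_mul, Complex.exp_add]
        simp only [mulNeg, h₁, h₂, mulPos, Matrix.mul_apply, Fin.sum_univ_two]
        constructor <;> module }

/-- The twistor space `M_Z^s` as the quotient of `M_V` by the two actions. -/
def TwistorSpace (n : ℕ) (s : Kind) : Type := Quotient (twistorSetoid n s)

/-- The projection `M_V → M_S → M_Z^s`. -/
def toTwistor {n : ℕ} (s : Kind) (u : Stiefel n) : TwistorSpace n s :=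
  Quotient.mk (twistorSetoid n s) u

/-- The twistor spaces as bundles of endomorphisms in `Q` over the Grassmannian: the complex
structures with `a > 0`, the product structures, and the nilpotent structures with `a > 0`. -/
def twistorBundle (n : ℕ) : Kind → Set (EndBundle n)
  | .plus => {x | ∃ (u : Stiefel n) (a b c : ℝ), 0 < a ∧ pqEnd u a b c * pqEnd u a b c = (-1 : ℝ) • 1 ∧
      x = ⟨plane u, pqEnd u a b c⟩}
  | .minus => {x | ∃ (u : Stiefel n) (a b c : ℝ), pqEnd u a b c * pqEnd u a b c = 1 ∧
      x = ⟨plane u, pqEnd u a b c⟩}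
  | .zero => {x | ∃ (u : Stiefel n) (a b c : ℝ), 0 < a ∧ pqEnd u a b c * pqEnd u a b c = 0 ∧
      x = ⟨plane u, pqEnd u a b c⟩}

/-- The element of `Q` at `π^{VG}(u)` determined by a frame `u`: `I₁`, `I₂` or `I₁ + I₂`. -/
def frameStructure {n : ℕ} (u : Stiefel n) : Kind → Module.End ℝ (Tangent (plane u))
  | .plus => I₁ u
  | .minus => I₂ u
  | .zero => I₁ u + I₂ u

/-! ### The curves -/

/-- The vector `(cosh r, sinh r)`, or `(cosh r, i sinh r)`. -/
def startVec : Kind → ℝ → Fin 2 → ℂ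
  | .plus, r => ![(Real.cosh r : ℂ), (Real.sinh r : ℂ)]
  | .minus, r => ![(Real.cosh r : ℂ), Complex.I * (Real.sinh r : ℂ)]
  | .zero, r => ![(Real.cosh r : ℂ), Complex.I * (Real.sinh r : ℂ)]

/-- The coordinates of `γ_r^s(t)` with respect to `(u₋, u₊)`. -/
def curveCoord (s : Kind) (r t : ℝ) : Fin 2 → ℂ := oneParam s t *ᵥ startVec s r

theorem curveCoord_norm (s : Kind) (r t : ℝ) :
    -(curveCoord s r t 0 * conj (curveCoord s r t 0)) +
      curveCoord s r t 1 * conj (curveCoord s r t 1) = -1 := by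
  have hr := Real.cosh_sq r
  have ht := Real.cosh_sq t
  have he : Complex.normSq (Complex.exp (t * Complex.I)) = 1 := by
    rw [Complex.normSq_eq_norm_sq, Complex.norm_exp_ofReal_mul_I, one_pow]
  have he' : Complex.normSq (Complex.exp (-(t * Complex.I))) = 1 := by
    rw [Complex.exp_neg, Complex.normSq_inv, he, inv_one]
  rw [Complex.mul_conj, Complex.mul_conj]
  norm_cast
  push_cast
  cases s
  · simp only [curveCoord, oneParam, startVec, Matrix.mulVec, dotProduct, Fin.sum_univ_two,
      Matrix.of_apply, Matrix.cons_val_zero, Matrix.cons_val_one, zero_mul, add_zero, zero_add,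
      Complex.normSq_mul, he, he', Complex.normSq_ofReal]
    linarith
  · simp [curveCoord, oneParam, startVec, Matrix.mulVec, dotProduct, Fin.sum_univ_two,
      Complex.normSq_apply, -Complex.ofReal_cosh, -Complex.ofReal_sinh]
    linear_combination (Real.sinh r ^ 2 - Real.cosh r ^ 2) * ht - hr
  · simp [curveCoord, oneParam, startVec, Matrix.mulVec, dotProduct, Fin.sum_univ_two,
      Complex.normSq_apply, -Complex.ofReal_cosh, -Complex.ofReal_sinh]
    linear_combination -hr

/-- The curves `γ_r^s(t) = (u₋, u₊) · oneParam s t · startVec s r` in `H₁^{2n+1}`. -/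
def gamma {n : ℕ} (s : Kind) (u : Stiefel n) (r t : ℝ) : AntiDeSitter n :=
  ⟨curveCoord s r t 0 • u.neg + curveCoord s r t 1 • u.pos, by
    rw [← curveCoord_norm s r t]
    simp only [herm_add_left, herm_add_right, herm_smul_left, herm_smul_right, u.herm_neg,
      u.herm_pos, u.herm_neg_pos, u.herm_pos_neg]
    ring⟩

/-- The curves `π₋ ∘ γ_r^s` in `CHⁿ`. -/
def curve {n : ℕ} (s : Kind) (u : Stiefel n) (r t : ℝ) : CH n := hopf (gamma s u r t)

/-- The family, indexed by `r`, of the (unparametrized) curves `π₋ ∘ γ_r^s`. -/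
def curveFamily {n : ℕ} (s : Kind) (u : Stiefel n) : ℝ → Set (CH n) :=
  fun r => Set.range (curve s u r)

/-- The set of all families `{π₋ ∘ γ_r^s}`. -/
def curveFamilies (n : ℕ) (s : Kind) : Set (ℝ → Set (CH n)) := Set.range (curveFamily s)

/-- The range of the curvatures: `κ > 2`, `0 ≤ κ < 2` or `κ = 2`. -/
def AdmissibleCurvature : Kind → ℝ → Prop
  | .plus, κ => 2 < κ
  | .minus, κ => 0 ≤ κ ∧ κ < 2
  | .zero, κ => κ = 2

/-- For `s = +` the curve with `r = 0` is a single point and is left out. -/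
def AdmissibleRadius : Kind → ℝ → Prop
  | .plus, r => r ≠ 0
  | .minus, _ => True
  | .zero, _ => True

end CHTwistor

end

open CHTwistor

open CHTwistor

namespace CHTwistor

/-! ### The metric and the Levi-Civita connection in the chart -/

/-! Everything is pulled back along the Hopf fibration to linear algebra in $\mathbb C_1^{n+1}$. In
the ball chart, Koszul's formula gives $\nabla_XX=\frac{2\langle X,z\rangle}{1-|z|^2}X$ for a
constant field $X$ (`christoffel_self`): a complex multiple of $X$. For a curve with any lift $w$,
not necessarily horizontal, this says that the acceleration is the image under the differential of
the chart of $w''+2((w',w))\,w'$ (`IsLift.isAcceleration_iff`), and multiples of $w$ do not count.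

Curves. Each $E_s$ is generated by a matrix $N$ with $N^2=\varepsilon$, $\varepsilon=-1,1,0$ for
$s=+,-,0$. Hence $\gamma''=\varepsilon\gamma$ is vertical, and with $((\gamma',\gamma))=i\beta$ the
acceleration of the projected curve is $2i\beta$ times its velocity, while its squared speed is
$\varepsilon+\beta^2$. So $\kappa=2|\beta|/\sqrt{\varepsilon+\beta^2}$, where $\beta$ is $-\cosh
2r$, $-\sinh 2r$, $-e^{2r}$. In the direction of $r$ the lift is horizontal and equal to its own
second derivative, hence projects to a geodesic.

Converse. A horizontal lift $w$ of a unit speed curve in the line of $P$ gives a frame $(w,w')$ of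
$P$, and $w''=w+ikw'$ with $|k|=\kappa$. By continuity $k$ is constant, so $w$ solves a linear
equation with constant coefficients. The curve $e^{i\lambda t}\gamma_r^s(at)$ solves the same
equation for suitable $r,a,\lambda$ (`exists_radius`), and the frame is chosen to match the initial
values.

Twistor spaces. Frames of the same plane differ by some $h\in U(1,1)$. The centralizer of $N$ in
$U(1,1)$ is $\{e^{i\theta}E_s(t)\}$ (`IsU11.exists_of_commute`), so two frames are equivalent
exactly when $h$ commutes with $N$ (`rel_iff_exists_commute`). Since $I_1$, $I_2$, $I_1+I_2$ are
right multiplication by $N$, this gives injectivity into the bundle; surjectivity is transitivity of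
$U(1,1)$ on each of the quadrics $-a^2+b^2+c^2=\varepsilon$, with $a>0$ where required
(`exists_conjugate`). For families of curves, the members $r=0$ and $r=1$ already force $h$ to
commute with $N$ (`rel_of_curveFamily_eq`). -/

/-- The standard Hermitian product of `ℂⁿ`. -/
noncomputable def dotc {n : ℕ} (x y : Fin n → ℂ) : ℂ := ∑ j, x j * conj (y j)

theorem dotc_add_left {n : ℕ} (x y w : Fin n → ℂ) : dotc (x + y) w = dotc x w + dotc y w := by
  simp only [dotc, Pi.add_apply, add_mul, Finset.sum_add_distrib]

theorem dotc_smul_left {n : ℕ} (a : ℂ) (x w : Fin n → ℂ) : dotc (a • x) w = a * dotc x w := by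
  simp only [dotc, Pi.smul_apply, smul_eq_mul, Finset.mul_sum, mul_assoc]

theorem dotc_conj {n : ℕ} (x w : Fin n → ℂ) : conj (dotc x w) = dotc w x := by
  simp only [dotc, map_sum, map_mul, Complex.conj_conj]
  exact Finset.sum_congr rfl fun j _ => mul_comm _ _

theorem dotc_add_right {n : ℕ} (x y w : Fin n → ℂ) : dotc w (x + y) = dotc w x + dotc w y := by
  rw [← dotc_conj, dotc_add_left, map_add, dotc_conj, dotc_conj]

theorem dotc_smul_right {n : ℕ} (a : ℂ) (x w : Fin n → ℂ) :
    dotc w (a • x) = conj a * dotc w x := by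
  rw [← dotc_conj, dotc_smul_left, map_mul, dotc_conj]

theorem dotc_self {n : ℕ} (z : Fin n → ℂ) : dotc z z = ((∑ j, Complex.normSq (z j) : ℝ) : ℂ) := by
  simp only [dotc, Complex.mul_conj, Complex.ofReal_sum]

theorem defect_eq {n : ℕ} (z : Fin n → ℂ) : defect z = 1 - (dotc z z).re := by
  rw [dotc_self, Complex.ofReal_re, defect]

theorem defect_coe {n : ℕ} (z : Fin n → ℂ) : (defect z : ℂ) = 1 - dotc z z := by
  rw [dotc_self, defect]
  push_cast
  rfl

theorem herm_cons {n : ℕ} (a b : ℂ) (X Y : Fin n → ℂ) :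
    herm (Fin.cons a X : Fin (n + 1) → ℂ) (Fin.cons b Y : Fin (n + 1) → ℂ) =
      -(a * conj b) + dotc X Y := by
  simp [herm, dotc]

/-- Because `dotc z z = 1 - defect z`, the terms produced by the vertical corrections in the two
horizontal lifts collapse to a single one. The outcome is the Bergman metric of the ball, up to
scale. -/
theorem metric_eq {n : ℕ} {z : Fin n → ℂ} (hz : 0 < defect z) (X Y : Fin n → ℂ) :
    metric z X Y = (dotc X Y).re / defect z +
      (dotc X z * conj (dotc Y z)).re / defect z ^ 2 := by
  have hD : (defect z : ℂ) ≠ 0 := by exact_mod_cast hz.ne'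
  have hs : ((Real.sqrt (defect z) : ℂ))⁻¹ * ((Real.sqrt (defect z) : ℂ))⁻¹ =
      (defect z : ℂ)⁻¹ := by
    rw [← mul_inv, ← Complex.ofReal_mul, Real.mul_self_sqrt hz.le]
  have h1 := defect_coe z
  have key : herm (horLift z X) (horLift z Y) =
      dotc X Y / (defect z : ℝ) + dotc X z * conj (dotc Y z) / ((defect z ^ 2 : ℝ) : ℂ) := by
    change herm (_ • (_ + (dotc X z / (defect z : ℂ)) • _))
      (_ • (_ + (dotc Y z / (defect z : ℂ)) • _)) = _
    rw [herm_smul_left, herm_smul_right, map_inv₀, Complex.conj_ofReal, ← mul_assoc, hs]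
    simp only [herm_add_left, herm_add_right, herm_smul_left, herm_smul_right, herm_cons]
    simp only [Complex.conj_ofReal, map_div₀, dotc_conj]
    have : dotc z z = 1 - (defect z : ℂ) := by rw [h1]; ring
    rw [this]
    push_cast
    field_simp
    simp only [map_zero, map_one]
    ring
  rw [metric, key, Complex.add_re, Complex.div_ofReal_re, Complex.div_ofReal_re]

theorem metric_self_pos {n : ℕ} {z X : Fin n → ℂ} (hz : 0 < defect z) (hX : X ≠ 0) :
    0 < metric z X X := by
  rw [metric_eq hz, dotc_self, Complex.mul_conj, Complex.ofReal_re, Complex.ofReal_re]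
  have h : 0 < ∑ j, Complex.normSq (X j) := by
    obtain ⟨j, hj⟩ := Function.ne_iff.1 hX
    exact Finset.sum_pos' (fun i _ => Complex.normSq_nonneg _)
      ⟨j, Finset.mem_univ _, Complex.normSq_pos.2 hj⟩
  have := Complex.normSq_nonneg (dotc X z)
  positivity

theorem metric_sub_left {n : ℕ} {z : Fin n → ℂ} (hz : 0 < defect z) (X X' Y : Fin n → ℂ) :
    metric z (X - X') Y = metric z X Y - metric z X' Y := by
  have h : ∀ w, dotc (X - X') w = dotc X w - dotc X' w := fun w => by
    rw [sub_eq_add_neg, dotc_add_left, ← neg_one_smul ℂ X', dotc_smul_left]; ring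
  simp only [metric_eq hz, h, sub_mul, Complex.sub_re]
  ring

theorem metric_add_left {n : ℕ} {z : Fin n → ℂ} (hz : 0 < defect z) (X X' Y : Fin n → ℂ) :
    metric z (X + X') Y = metric z X Y + metric z X' Y := by
  simp only [metric_eq hz, dotc_add_left, add_mul, Complex.add_re]
  ring

theorem metricDeriv_eq {n : ℕ} {z : Fin n → ℂ} (hz : 0 < defect z) (W X Y : Fin n → ℂ) :
    metricDeriv z W X Y = 2 * (dotc W z).re * (dotc X Y).re / defect z ^ 2 +
      (dotc X W * conj (dotc Y z) + dotc X z * conj (dotc Y W)).re / defect z ^ 2 +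
      4 * (dotc W z).re * (dotc X z * conj (dotc Y z)).re / defect z ^ 3 := by
  have hsm : ∀ τ : ℝ, z + τ • W = z + (τ : ℂ) • W := fun τ => by
    rw [Complex.coe_smul]
  have hdef : ∀ τ : ℝ, defect (z + τ • W) =
      defect z - 2 * (dotc W z).re * τ - (dotc W W).re * τ ^ 2 := fun τ => by
    have : (dotc z W).re = (dotc W z).re := by rw [← dotc_conj, Complex.conj_re]
    rw [hsm, defect_eq, defect_eq, dotc_add_left, dotc_add_right, dotc_add_right, dotc_smul_left,
      dotc_smul_left, dotc_smul_right, dotc_smul_right, Complex.conj_ofReal]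
    simp only [Complex.add_re, Complex.re_ofReal_mul, this]
    ring
  have hd : HasDerivAt (fun τ : ℝ => defect (z + τ • W)) (-(2 * (dotc W z).re)) 0 := by
    simp only [hdef]
    have h := (((hasDerivAt_id (0 : ℝ)).const_mul (2 * (dotc W z).re)).const_sub (defect z)).sub
      (((hasDerivAt_id (0 : ℝ)).pow 2).const_mul (dotc W W).re)
    exact h.congr_deriv (by simp)
  have hn : HasDerivAt (fun τ : ℝ => (dotc X (z + τ • W) * conj (dotc Y (z + τ • W))).re)
      (dotc X W * conj (dotc Y z) + dotc X z * conj (dotc Y W)).re 0 := by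
    have e : ∀ τ : ℝ, (dotc X (z + τ • W) * conj (dotc Y (z + τ • W))).re =
        (dotc X z * conj (dotc Y z)).re +
        (dotc X W * conj (dotc Y z) + dotc X z * conj (dotc Y W)).re * τ +
        (dotc X W * conj (dotc Y W)).re * τ ^ 2 := fun τ => by
      simp only [hsm, dotc_add_right, dotc_smul_right, Complex.conj_ofReal, map_add, map_mul,
        Complex.add_re, Complex.mul_re, Complex.add_im, Complex.mul_im, Complex.ofReal_re,
        Complex.ofReal_im, Complex.conj_re, Complex.conj_im]
      ring
    simp only [e]
    have h := (((hasDerivAt_id (0 : ℝ)).const_mul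
      (dotc X W * conj (dotc Y z) + dotc X z * conj (dotc Y W)).re).const_add
      (dotc X z * conj (dotc Y z)).re).add
      (((hasDerivAt_id (0 : ℝ)).pow 2).const_mul (dotc X W * conj (dotc Y W)).re)
    exact h.congr_deriv (by simp)
  have h0 : z + (0 : ℝ) • W = z := by simp
  -- The closed formula is valid only inside the ball, hence only for `τ` near `0`.
  have hev : (fun τ : ℝ => metric (z + τ • W) X Y) =ᶠ[nhds 0] fun τ : ℝ =>
      (dotc X Y).re / defect (z + τ • W) +
      (dotc X (z + τ • W) * conj (dotc Y (z + τ • W))).re / defect (z + τ • W) ^ 2 := by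
    have : ∀ᶠ τ in nhds (0 : ℝ), 0 < defect (z + τ • W) := by
      refine hd.continuousAt.eventually (lt_mem_nhds ?_)
      simpa only [h0] using hz
    filter_upwards [this] with τ hτ using metric_eq hτ X Y
  rw [metricDeriv, hev.deriv_eq]
  have hne : defect (z + (0 : ℝ) • W) ≠ 0 := by rw [h0]; exact hz.ne'
  have h := ((hasDerivAt_const (0 : ℝ) (dotc X Y).re).div hd hne).add
    (hn.div (hd.pow 2) (pow_ne_zero 2 hne))
  refine h.deriv.trans ?_
  simp only [h0, Pi.pow_apply]
  have := hz.ne'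
  field_simp
  push_cast
  ring

/-- On the diagonal the Levi-Civita connection multiplies `X` by a complex number. This one fact is
behind both the totally geodesic lines and the acceleration formula for lifts. -/
theorem christoffel_self {n : ℕ} {z : Fin n → ℂ} (hz : 0 < defect z) (X Z : Fin n → ℂ) :
    christoffel z X X Z = metric z ((2 * dotc X z / (defect z : ℂ)) • X) Z := by
  have hXX : (dotc X X).im = 0 := by rw [dotc_self, Complex.ofReal_im]
  have hZX : dotc Z X = conj (dotc X Z) := (dotc_conj X Z).symm
  rw [christoffel, metric_eq hz]
  simp only [metricDeriv_eq hz, dotc_smul_left, hZX]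
  rw [show 2 * dotc X z / (defect z : ℂ) = ((2 / defect z : ℝ) : ℂ) * dotc X z by
    push_cast; ring]
  simp only [Complex.add_re, Complex.mul_re, Complex.mul_im, Complex.conj_re, Complex.conj_im,
    Complex.ofReal_re, Complex.ofReal_im, hXX]
  have := hz.ne'
  field_simp
  ring

/-- Positive definiteness of the metric turns the weak definition, tested against all `Z`, into an
explicit vector; in particular the acceleration is unique. -/
theorem isAcceleration_iff {n : ℕ} {c : ℝ → CH n} {t : ℝ} (hz : 0 < defect (chart (c t)))
    (V : Fin n → ℂ) : IsAcceleration c t V ↔ V = deriv (velocity c) t +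
      (2 * dotc (velocity c t) (chart (c t)) / (defect (chart (c t)) : ℂ)) • velocity c t := by
  set U := deriv (velocity c) t +
      (2 * dotc (velocity c t) (chart (c t)) / (defect (chart (c t)) : ℂ)) • velocity c t with hU
  have h : ∀ Z, metric (chart (c t)) (deriv (velocity c) t) Z +
      christoffel (chart (c t)) (velocity c t) (velocity c t) Z = metric (chart (c t)) U Z :=
    fun Z => by rw [christoffel_self hz, hU, metric_add_left hz]
  simp only [IsAcceleration, h]
  refine ⟨fun hV => ?_, fun hV Z => by rw [hV]⟩
  by_contra hne
  have hpos := metric_self_pos hz (sub_ne_zero.2 hne)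
  rw [metric_sub_left hz, hV, sub_self] at hpos
  exact lt_irrefl _ hpos

/-! ### Curves in `CHⁿ` through their lifts to the anti de Sitter space -/

/-- The differential at `w` of `w ↦ (w₁/w₀, …, wₙ/w₀)`. -/
noncomputable def dchart {n : ℕ} (w W : Fin (n + 1) → ℂ) : Fin n → ℂ :=
  fun j => (W j.succ - w j.succ / w 0 * W 0) / w 0

theorem dchart_add {n : ℕ} (w W W' : Fin (n + 1) → ℂ) :
    dchart w (W + W') = dchart w W + dchart w W' := by
  funext j
  simp only [dchart, Pi.add_apply]
  ring

theorem dchart_smul {n : ℕ} (a : ℂ) (w W : Fin (n + 1) → ℂ) :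
    dchart w (a • W) = a • dchart w W := by
  funext j
  simp only [dchart, Pi.smul_apply, smul_eq_mul]
  ring

theorem herm_eq {n : ℕ} (z w : Fin (n + 1) → ℂ) :
    herm z w = -(z 0 * conj (w 0)) + dotc (Fin.tail z) (Fin.tail w) := rfl

theorem zero_ne_of_herm {n : ℕ} {w : Fin (n + 1) → ℂ} (hw : herm w w = -1) : w 0 ≠ 0 := by
  intro h
  rw [herm_eq, dotc_self, h] at hw
  have h1 := congrArg Complex.re hw
  simp only [zero_mul, neg_zero, zero_add, Complex.ofReal_re, Complex.neg_re,
    Complex.one_re] at h1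
  have : 0 ≤ ∑ j, Complex.normSq (Fin.tail w j) := Finset.sum_nonneg fun _ _ => Complex.normSq_nonneg _
  linarith

theorem chart_hopf {n : ℕ} (w : AntiDeSitter n) :
    chart (hopf w) = (w.1 0)⁻¹ • Fin.tail w.1 := by
  funext j
  exact div_eq_inv_mul _ _

theorem chart_hopf_apply {n : ℕ} (w : AntiDeSitter n) (j : Fin n) :
    chart (hopf w) j = w.1 j.succ / w.1 0 := rfl

theorem eq_smul_cons_chart {n : ℕ} (w : AntiDeSitter n) :
    w.1 = w.1 0 • (Fin.cons 1 (chart (hopf w)) : Fin (n + 1) → ℂ) := by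
  have h0 := zero_ne_of_herm w.2
  funext j
  refine Fin.cases ?_ (fun i => ?_) j
  · simp
  · simp only [Pi.smul_apply, Fin.cons_succ, chart_hopf_apply, smul_eq_mul]
    field_simp

/-- The kernel of the differential of the chart at `w` is the complex line through `w`; this splits
`W` into a chart part and a multiple of `w`. -/
theorem eq_smul_cons_dchart {n : ℕ} (w : AntiDeSitter n) (W : Fin (n + 1) → ℂ) :
    W = w.1 0 • (Fin.cons 0 (dchart w.1 W) : Fin (n + 1) → ℂ) + (W 0 / w.1 0) • w.1 := by
  have h0 := zero_ne_of_herm w.2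
  funext j
  refine Fin.cases ?_ (fun i => ?_) j
  · simp [h0]
  · simp only [Pi.smul_apply, Pi.add_apply, Fin.cons_succ, dchart, smul_eq_mul]
    field_simp
    ring

theorem hopf_surjective {n : ℕ} : Function.Surjective (hopf : AntiDeSitter n → CH n) :=
  Quotient.mk_surjective

theorem defect_hopf {n : ℕ} (w : AntiDeSitter n) :
    (defect (chart (hopf w)) : ℂ) = (w.1 0 * conj (w.1 0))⁻¹ := by
  have h0 := zero_ne_of_herm w.2
  have h0' : conj (w.1 0) ≠ 0 := (map_ne_zero _).2 h0
  have h := w.2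
  rw [herm_eq] at h
  rw [defect_coe, chart_hopf, dotc_smul_left, dotc_smul_right,
    show dotc (Fin.tail w.1) (Fin.tail w.1) = -1 + w.1 0 * conj (w.1 0) by
      linear_combination h, map_inv₀]
  field_simp
  ring

theorem defect_pos {n : ℕ} (p : CH n) : 0 < defect (chart p) := by
  obtain ⟨w, rfl⟩ := hopf_surjective p
  have h := defect_hopf w
  rw [Complex.mul_conj, ← Complex.ofReal_inv, Complex.ofReal_inj] at h
  rw [h]
  exact inv_pos.2 (Complex.normSq_pos.2 (zero_ne_of_herm w.2))

theorem herm_cons_zero {n : ℕ} (w : AntiDeSitter n) (X : Fin n → ℂ) :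
    herm (Fin.cons 0 X : Fin (n + 1) → ℂ) w.1 = conj (w.1 0) * dotc X (chart (hopf w)) := by
  conv_lhs => rw [eq_smul_cons_chart w]
  rw [herm_smul_right, herm_cons]
  simp

/-- Expresses the Christoffel coefficient through the lift. The non-invariant term `W 0 / w.1 0`
later cancels against the one coming from the second derivative of the quotients `wⱼ / w₀`. -/
theorem dotc_dchart {n : ℕ} (w : AntiDeSitter n) (W : Fin (n + 1) → ℂ) :
    dotc (dchart w.1 W) (chart (hopf w)) / (defect (chart (hopf w)) : ℂ) =
      herm W w.1 + W 0 / w.1 0 := by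
  have h : herm W w.1 = herm (w.1 0 • (Fin.cons 0 (dchart w.1 W) : Fin (n + 1) → ℂ) +
      (W 0 / w.1 0) • w.1) w.1 := by rw [← eq_smul_cons_dchart]
  rw [h, herm_add_left, herm_smul_left, herm_smul_left, herm_cons_zero, w.2, defect_hopf,
    div_inv_eq_mul]
  ring

/-- As `((w, w)) = -1`, the horizontal part of `W` is `W + ((W, w)) w`; the right side is the real
part of the form on the horizontal parts. Thus $\pi_-$ is a Riemannian submersion for the metric
defined in the chart. -/
theorem metric_dchart {n : ℕ} (w : AntiDeSitter n) (W W' : Fin (n + 1) → ℂ) :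
    metric (chart (hopf w)) (dchart w.1 W) (dchart w.1 W') =
      (herm W W' + herm W w.1 * conj (herm W' w.1)).re := by
  have h0 := zero_ne_of_herm w.2
  have h0' : conj (w.1 0) ≠ 0 := (map_ne_zero _).2 h0
  have h1 : herm W w.1 = w.1 0 * (conj (w.1 0) * dotc (dchart w.1 W) (chart (hopf w))) -
      W 0 / w.1 0 := by
    have := dotc_dchart w W
    rw [defect_hopf, div_inv_eq_mul] at this
    linear_combination -this
  have h1' : herm W' w.1 = w.1 0 * (conj (w.1 0) * dotc (dchart w.1 W') (chart (hopf w))) -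
      W' 0 / w.1 0 := by
    have := dotc_dchart w W'
    rw [defect_hopf, div_inv_eq_mul] at this
    linear_combination -this
  have h2 : herm W W' = w.1 0 * conj (w.1 0) * dotc (dchart w.1 W) (dchart w.1 W') +
      conj (W' 0 / w.1 0) * herm W w.1 +
      (W 0 / w.1 0) * conj (herm W' w.1) + (W 0 / w.1 0) * conj (W' 0 / w.1 0) := by
    have e : herm W W' = herm (w.1 0 • (Fin.cons 0 (dchart w.1 W) : Fin (n + 1) → ℂ) +
      (W 0 / w.1 0) • w.1) (w.1 0 • (Fin.cons 0 (dchart w.1 W') : Fin (n + 1) → ℂ) +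
      (W' 0 / w.1 0) • w.1) := by rw [← eq_smul_cons_dchart, ← eq_smul_cons_dchart]
    rw [e, herm_add_left, herm_add_right, herm_add_right]
    simp only [herm_smul_left, herm_smul_right, herm_cons, herm_cons_zero, w.2]
    rw [← herm_conj _ w.1, herm_cons_zero, h1, h1']
    simp only [map_sub, map_mul, map_div₀, Complex.conj_conj, map_zero]
    ring
  have key : herm W W' + herm W w.1 * conj (herm W' w.1) =
      dotc (dchart w.1 W) (dchart w.1 W') / ((defect (chart (hopf w)) : ℝ) : ℂ) +
      dotc (dchart w.1 W) (chart (hopf w)) * conj (dotc (dchart w.1 W') (chart (hopf w))) /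
        ((defect (chart (hopf w)) ^ 2 : ℝ) : ℂ) := by
    push_cast
    rw [defect_hopf, h2, h1, h1']
    simp only [map_sub, map_mul, map_div₀, Complex.conj_conj]
    field_simp
    ring
  rw [key, metric_eq (defect_pos _), Complex.add_re, Complex.div_ofReal_re, Complex.div_ofReal_re]

/-- `w` is a twice differentiable lift of the curve `c` to the anti de Sitter space, with first
and second derivatives `w₁` and `w₂`. -/
structure IsLift {n : ℕ} (c : ℝ → CH n) (w : ℝ → AntiDeSitter n)
    (w₁ w₂ : ℝ → Fin (n + 1) → ℂ) : Prop where
  hopf_eq : ∀ t, c t = hopf (w t)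
  hasDerivAt : ∀ t, HasDerivAt (fun τ => (w τ).1) (w₁ t) t
  hasDerivAt' : ∀ t, HasDerivAt w₁ (w₂ t) t

theorem IsLift.velocity_eq {n : ℕ} {c : ℝ → CH n} {w : ℝ → AntiDeSitter n}
    {w₁ w₂ : ℝ → Fin (n + 1) → ℂ} (h : IsLift c w w₁ w₂) (t : ℝ) :
    velocity c t = dchart (w t).1 (w₁ t) := by
  have h0 := zero_ne_of_herm (w t).2
  refine HasDerivAt.deriv (hasDerivAt_pi.2 fun j => ?_)
  simp only [h.hopf_eq, chart_hopf_apply]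
  have hd := hasDerivAt_pi.1 (h.hasDerivAt t)
  refine ((hd j.succ).div (hd 0) h0).congr_deriv ?_
  simp only [dchart]
  field_simp

theorem IsLift.deriv_velocity_eq {n : ℕ} {c : ℝ → CH n} {w : ℝ → AntiDeSitter n}
    {w₁ w₂ : ℝ → Fin (n + 1) → ℂ} (h : IsLift c w w₁ w₂) (t : ℝ) :
    deriv (velocity c) t =
      dchart (w t).1 (w₂ t) - (2 * (w₁ t 0 / (w t).1 0)) • dchart (w t).1 (w₁ t) := by
  have h0 := zero_ne_of_herm (w t).2
  refine HasDerivAt.deriv (hasDerivAt_pi.2 fun j => ?_)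
  simp only [h.velocity_eq, dchart]
  have hd := hasDerivAt_pi.1 (h.hasDerivAt t)
  have hd' := hasDerivAt_pi.1 (h.hasDerivAt' t)
  refine ((((hd' j.succ).sub (((hd j.succ).div (hd 0) h0).mul (hd' 0))).div (hd 0) h0)).congr_deriv
    ?_
  simp only [dchart, Pi.sub_apply, Pi.smul_apply, smul_eq_mul, Pi.mul_apply, Pi.div_apply]
  field_simp
  ring

theorem IsLift.isAcceleration_iff {n : ℕ} {c : ℝ → CH n} {w : ℝ → AntiDeSitter n}
    {w₁ w₂ : ℝ → Fin (n + 1) → ℂ} (h : IsLift c w w₁ w₂) (t : ℝ) (V : Fin n → ℂ) :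
    IsAcceleration c t V ↔
      V = dchart (w t).1 (w₂ t) + (2 * herm (w₁ t) (w t).1) • dchart (w t).1 (w₁ t) := by
  rw [CHTwistor.isAcceleration_iff (defect_pos _), h.deriv_velocity_eq, h.velocity_eq, h.hopf_eq t,
    mul_div_assoc, dotc_dchart]
  have : ∀ A B : Fin n → ℂ, ∀ p q : ℂ, A - (2 * q) • B + (2 * (p + q)) • B = A + (2 * p) • B := by
    intros; module
  rw [this]

theorem IsLift.metric_velocity {n : ℕ} {c : ℝ → CH n} {w : ℝ → AntiDeSitter n}
    {w₁ w₂ : ℝ → Fin (n + 1) → ℂ} (h : IsLift c w w₁ w₂) (t : ℝ) :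
    speedSq c t =
      (herm (w₁ t) (w₁ t) + herm (w₁ t) (w t).1 * conj (herm (w₁ t) (w t).1)).re := by
  rw [speedSq, h.velocity_eq, h.hopf_eq, metric_dchart]

theorem isSmoothCurve_of_lift {n : ℕ} {c : ℝ → CH n} {w : ℝ → AntiDeSitter n}
    (h : ∀ t, c t = hopf (w t)) (hw : ContDiff ℝ ∞ fun t => (w t).1) : IsSmoothCurve c := by
  refine contDiff_pi.2 fun j => ?_
  simp only [h, chart_hopf_apply, div_eq_mul_inv]
  have := contDiff_pi.1 hw
  exact (this j.succ).mul ((this 0).inv fun t => zero_ne_of_herm (w t).2)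

/-- Both vectors have norm `-1`, so the factor `a` automatically has modulus one. -/
theorem hopf_eq_of_smul {n : ℕ} {w w' : AntiDeSitter n} {a : ℂ} (h : w'.1 = a • w.1) :
    hopf w = hopf w' := by
  have hn := w'.2
  rw [h, herm_smul_left, herm_smul_right, w.2, ← mul_assoc, Complex.mul_conj,
    Complex.normSq_eq_norm_sq] at hn
  have h1 : ‖a‖ ^ 2 = 1 := by
    have : ((‖a‖ ^ 2 : ℝ) : ℂ) = 1 := by linear_combination -hn
    exact_mod_cast this
  have h2 : ‖a‖ = 1 := (pow_eq_one_iff_of_nonneg (norm_nonneg _) two_ne_zero).1 h1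
  refine Quotient.sound ⟨Complex.arg a, ?_⟩
  have := Complex.norm_mul_exp_arg_mul_I a
  rw [h2, Complex.ofReal_one, one_mul] at this
  rw [this, h]

theorem exists_smul_of_hopf_eq {n : ℕ} {w w' : AntiDeSitter n} (h : hopf w = hopf w') :
    ∃ θ : ℝ, w'.1 = Complex.exp (θ * Complex.I) • w.1 := Quotient.exact h

theorem mem_hyperbolicLine_iff {n : ℕ} {P : Submodule ℂ (Fin (n + 1) → ℂ)} (w : AntiDeSitter n) :
    hopf w ∈ hyperbolicLine P ↔ w.1 ∈ P := by
  refine ⟨?_, fun h => ⟨w, h, rfl⟩⟩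
  rintro ⟨w', hw', h⟩
  obtain ⟨θ, e⟩ := exists_smul_of_hopf_eq h
  rw [e]
  exact P.smul_mem _ hw'

/-- In the chart the subset is the intersection of the ball with an affine complex subspace, which
is what makes geodesics easy to follow. -/
theorem mem_hyperbolicLine_iff_cons {n : ℕ} {P : Submodule ℂ (Fin (n + 1) → ℂ)} (p : CH n) :
    p ∈ hyperbolicLine P ↔ (Fin.cons 1 (chart p) : Fin (n + 1) → ℂ) ∈ P := by
  obtain ⟨w, rfl⟩ := hopf_surjective p
  rw [mem_hyperbolicLine_iff]
  conv_lhs => rw [eq_smul_cons_chart w]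
  exact P.smul_mem_iff (zero_ne_of_herm w.2)

/-! ### Complex hyperbolic lines are totally geodesic -/

theorem hasDerivAt_cons {n : ℕ} {a : ℂ} {f : ℝ → Fin n → ℂ} {f' : Fin n → ℂ} {t : ℝ}
    (hf : HasDerivAt f f' t) :
    HasDerivAt (fun τ => (Fin.cons a (f τ) : Fin (n + 1) → ℂ)) (Fin.cons 0 f') t := by
  refine hasDerivAt_pi.2 fun j => Fin.cases ?_ (fun i => ?_) j
  · simpa using hasDerivAt_const t a
  · simpa using hasDerivAt_pi.1 hf i

theorem mem_of_hasDerivAt {n : ℕ} {P : Submodule ℂ (Fin n → ℂ)} {f : ℝ → Fin n → ℂ}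
    {f' : Fin n → ℂ} {t : ℝ} (hf : HasDerivAt f f' t) (hP : ∀ τ, f τ ∈ P) : f' ∈ P := by
  have hc : IsClosed (P : Set (Fin n → ℂ)) := P.closed_of_finiteDimensional
  have h := hf.tendsto_slope
  refine hc.mem_of_tendsto h (Filter.Eventually.of_forall fun τ => ?_)
  rw [slope_def_module]
  exact (P.restrictScalars ℝ).smul_mem _ (P.sub_mem (hP _) (hP _))

theorem IsSmoothCurve.hasDerivAt {n : ℕ} {c : ℝ → CH n} (hc : IsSmoothCurve c) (t : ℝ) :
    HasDerivAt (fun τ => chart (c τ)) (velocity c t) t :=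
  ((hc.differentiable (by simp)) t).hasDerivAt

theorem IsSmoothCurve.contDiff_velocity {n : ℕ} {c : ℝ → CH n} (hc : IsSmoothCurve c) :
    ContDiff ℝ ∞ (velocity c) :=
  ((contDiff_infty_iff_deriv (f := fun t => chart (c t))).1 hc).2

theorem IsSmoothCurve.hasDerivAt_velocity {n : ℕ} {c : ℝ → CH n} (hc : IsSmoothCurve c) (t : ℝ) :
    HasDerivAt (velocity c) (deriv (velocity c) t) t :=
  ((hc.contDiff_velocity.differentiable (by simp)) t).hasDerivAt

theorem continuous_dotc {n : ℕ} {x y : ℝ → Fin n → ℂ} (hx : Continuous x) (hy : Continuous y) :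
    Continuous fun t => dotc (x t) (y t) := by
  unfold dotc
  have := fun j => (continuous_apply j).comp hx
  have := fun j => (continuous_apply j).comp hy
  fun_prop

theorem continuous_defect {n : ℕ} {x : ℝ → Fin n → ℂ} (hx : Continuous x) :
    Continuous fun t => defect (x t) := by
  simp only [defect_eq]
  exact continuous_const.sub (Complex.continuous_re.comp (continuous_dotc hx hx))

/-- The geodesic equation reads $v'=-f v$ with a complex scalar function $f$, so the velocity stays
in the complex line of its initial value. The geodesic therefore runs, in the chart, inside the
affine complex line through its initial point in that direction. Only that `P` is a complex subspace
matters. -/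
theorem isTotallyGeodesic_hyperbolicLine {n : ℕ} (P : Submodule ℂ (Fin (n + 1) → ℂ)) :
    IsTotallyGeodesic (hyperbolicLine P) := by
  rintro c ⟨hc, hgeo⟩ t₀ h₀ ⟨b, hb, hbP, hb₀, hv⟩ t
  have hz : Continuous fun t => chart (c t) := hc.continuous
  have hV : Continuous (velocity c) := hc.contDiff_velocity.continuous
  set f : ℝ → ℂ := fun t => 2 * dotc (velocity c t) (chart (c t)) / (defect (chart (c t)) : ℂ)
    with hf
  have hfc : Continuous f := by
    refine (continuous_const.mul (continuous_dotc hV hz)).div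
      (Complex.continuous_ofReal.comp (continuous_defect hz)) fun t => ?_
    exact_mod_cast (defect_pos (c t)).ne'
  have hv' : ∀ t, HasDerivAt (velocity c) (-(f t • velocity c t)) t := fun t => by
    have h := (isAcceleration_iff (defect_pos _) _).1 (hgeo t)
    refine (hc.hasDerivAt_velocity t).congr_deriv ?_
    exact eq_neg_of_add_eq_zero_left h.symm
  -- An integrating factor: `exp (F t) • velocity c t` is constant.
  set F : ℝ → ℂ := fun t => ∫ τ in t₀..t, f τ with hF
  have hFd : ∀ t, HasDerivAt F (f t) t := fun t =>
    intervalIntegral.integral_hasDerivAt_right (hfc.intervalIntegrable _ _)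
      hfc.aestronglyMeasurable.stronglyMeasurableAtFilter hfc.continuousAt
  have hconst : ∀ t, Complex.exp (F t) • velocity c t = velocity c t₀ := fun t => by
    have hd : ∀ t, HasDerivAt (fun t => Complex.exp (F t) • velocity c t) 0 t := fun t => by
      refine ((hFd t).cexp.smul (hv' t)).congr_deriv ?_
      module
    have := is_const_of_deriv_eq_zero (fun t => (hd t).differentiableAt) (fun t => (hd t).deriv)
      t t₀
    rw [this, hF]
    simp
  have hvP : (Fin.cons 0 (velocity c t₀) : Fin (n + 1) → ℂ) ∈ P := by
    rw [← hv]
    exact mem_of_hasDerivAt (hasDerivAt_cons (a := 1) (hb.hasDerivAt 0)) fun τ =>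
      (mem_hyperbolicLine_iff_cons _).1 (hbP τ)
  have hvel : ∀ t, velocity c t = Complex.exp (-F t) • velocity c t₀ := fun t => by
    rw [← hconst t, smul_smul, ← Complex.exp_add]
    simp
  set G : ℝ → ℂ := fun t => ∫ τ in t₀..t, Complex.exp (-F τ) with hG
  have hgc : Continuous fun τ => Complex.exp (-F τ) := by
    have : Continuous F := continuous_iff_continuousAt.2 fun t => (hFd t).continuousAt
    fun_prop
  have hGd : ∀ t, HasDerivAt G (Complex.exp (-F t)) t := fun t =>
    intervalIntegral.integral_hasDerivAt_right (hgc.intervalIntegrable _ _)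
      hgc.aestronglyMeasurable.stronglyMeasurableAtFilter hgc.continuousAt
  have hd : ∀ t, HasDerivAt (fun t => chart (c t) - G t • velocity c t₀) 0 t := fun t => by
    refine ((hc.hasDerivAt t).sub ((hGd t).smul_const (velocity c t₀))).congr_deriv ?_
    rw [hvel, sub_self]
  have hfin := is_const_of_deriv_eq_zero (fun t => (hd t).differentiableAt)
    (fun t => (hd t).deriv) t t₀
  have hG0 : G t₀ = 0 := by simp [hG]
  rw [hG0, zero_smul, sub_zero, sub_eq_iff_eq_add] at hfin
  rw [mem_hyperbolicLine_iff_cons] at h₀ ⊢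
  have e : (Fin.cons 1 (chart (c t)) : Fin (n + 1) → ℂ) = Fin.cons 1 (chart (c t₀)) +
      G t • (Fin.cons 0 (velocity c t₀) : Fin (n + 1) → ℂ) := by
    funext j
    refine Fin.cases ?_ (fun i => ?_) j
    · simp
    · simp [hfin]
  rw [e]
  exact P.add_mem h₀ (P.smul_mem _ hvP)

/-! ### The one-parameter groups and their generators -/

/-- The generator of the one-parameter group of kind `s`. -/
noncomputable def gen : Kind → Matrix (Fin 2) (Fin 2) ℂ
  | .plus => !![Complex.I, 0; 0, -Complex.I]
  | .minus => !![0, 1; 1, 0]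
  | .zero => !![Complex.I, 1; 1, -Complex.I]

/-- The number `ε` with `gen s ^ 2 = ε`. -/
noncomputable def genSq : Kind → ℝ
  | .plus => -1
  | .minus => 1
  | .zero => 0

/-- Since the square of the generator is scalar, the second derivative of every $\gamma_r^s$ is a
multiple of $\gamma_r^s$ itself and disappears in the projection. -/
theorem gen_mul_gen (s : Kind) : gen s * gen s = (genSq s : ℂ) • 1 := by
  cases s <;> ext i j <;> fin_cases i <;> fin_cases j <;> simp [gen, genSq]

theorem oneParam_mul_gen (s : Kind) (t : ℝ) : oneParam s t * gen s = gen s * oneParam s t := by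
  cases s <;> ext i j <;> fin_cases i <;> fin_cases j <;>
    simp [gen, oneParam] <;> ring

theorem hasDerivAt_ofReal_cosh (t : ℝ) :
    HasDerivAt (fun τ : ℝ => ((Real.cosh τ : ℝ) : ℂ)) (Real.sinh t : ℂ) t :=
  (Real.hasDerivAt_cosh t).ofReal_comp

theorem hasDerivAt_ofReal_sinh (t : ℝ) :
    HasDerivAt (fun τ : ℝ => ((Real.sinh τ : ℝ) : ℂ)) (Real.cosh t : ℂ) t :=
  (Real.hasDerivAt_sinh t).ofReal_comp

theorem hasDerivAt_ofReal (t : ℝ) : HasDerivAt (fun τ : ℝ => (τ : ℂ)) 1 t :=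
  Complex.ofRealCLM.hasDerivAt

theorem hasDerivAt_oneParam (s : Kind) (i j : Fin 2) (t : ℝ) :
    HasDerivAt (fun τ => oneParam s τ i j) ((gen s * oneParam s t) i j) t := by
  have h1 := (hasDerivAt_ofReal t).mul_const Complex.I
  have hc := hasDerivAt_ofReal_cosh t
  have hs := hasDerivAt_ofReal_sinh t
  cases s <;> fin_cases i <;> fin_cases j <;> simp [gen, oneParam, -Complex.ofReal_cosh,
    -Complex.ofReal_sinh]
  · exact h1.cexp.congr_deriv (by ring)
  · exact hasDerivAt_const _ _
  · exact hasDerivAt_const _ _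
  · exact h1.neg.cexp.congr_deriv (by simp only [Pi.neg_apply]; ring)
  · exact hc
  · exact hs
  · exact hs
  · exact hc
  · exact h1.congr_deriv (by linear_combination -(t : ℂ) * Complex.I_mul_I)
  · exact (hasDerivAt_ofReal t).congr_deriv (by ring)
  · exact (hasDerivAt_ofReal t).congr_deriv (by ring)
  · exact (h1.const_sub 1).congr_deriv (by linear_combination -(t : ℂ) * Complex.I_mul_I)

/-- The matrix `h` belongs to `U(1,1)`. -/
structure IsU11 (h : Matrix (Fin 2) (Fin 2) ℂ) : Prop where
  neg_neg : -(h 0 0 * conj (h 0 0)) + h 1 0 * conj (h 1 0) = -1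
  pos_pos : -(h 0 1 * conj (h 0 1)) + h 1 1 * conj (h 1 1) = 1
  neg_pos : -(h 0 0 * conj (h 0 1)) + h 1 0 * conj (h 1 1) = 0

theorem IsU11.pos_neg {h : Matrix (Fin 2) (Fin 2) ℂ} (hh : IsU11 h) :
    -(h 0 1 * conj (h 0 0)) + h 1 1 * conj (h 1 0) = 0 := by
  have := congrArg conj hh.neg_pos
  simp only [map_add, map_neg, map_mul, Complex.conj_conj, map_zero] at this
  linear_combination this

/-- Coordinate vectors form the case `n = 1` of the ambient space, so `herm` serves also as the form
of signature (1,1) on coordinates, and `comb u` is an isometry. -/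
theorem herm_fin_two (ξ η : Fin 2 → ℂ) :
    herm ξ η = -(ξ 0 * conj (η 0)) + ξ 1 * conj (η 1) := by
  simp [herm]

theorem IsU11.herm_mulVec {h : Matrix (Fin 2) (Fin 2) ℂ} (hh : IsU11 h) (ξ η : Fin 2 → ℂ) :
    herm (h *ᵥ ξ) (h *ᵥ η) = herm ξ η := by
  simp only [herm_fin_two, Matrix.mulVec, dotProduct, Fin.sum_univ_two, map_add, map_mul]
  linear_combination ξ 0 * conj (η 0) * hh.neg_neg + ξ 1 * conj (η 1) * hh.pos_pos +
    ξ 0 * conj (η 1) * hh.neg_pos + ξ 1 * conj (η 0) * hh.pos_neg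

theorem isU11_oneParam (s : Kind) (t : ℝ) : IsU11 (oneParam s t) := by
  have he : Complex.exp (t * Complex.I) * Complex.exp (-(t * Complex.I)) = 1 := by
    rw [← Complex.exp_add, add_neg_cancel, Complex.exp_zero]
  have hc : (Real.cosh t : ℂ) ^ 2 = (Real.sinh t : ℂ) ^ 2 + 1 := by
    exact_mod_cast Real.cosh_sq t
  cases s <;> constructor <;> simp [oneParam, ← Complex.exp_conj, -Complex.ofReal_cosh,
    -Complex.ofReal_sinh]
  · exact he
  · rw [mul_comm]; exact he
  · linear_combination -hc
  · linear_combination hc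
  · ring
  · linear_combination (t : ℂ) ^ 2 * Complex.I_mul_I
  · linear_combination -(t : ℂ) ^ 2 * Complex.I_mul_I
  · ring

/-- The vector with coordinates `ξ` in the frame `u`. -/
noncomputable def comb {n : ℕ} (u : Stiefel n) (ξ : Fin 2 → ℂ) : Fin (n + 1) → ℂ :=
  ξ 0 • u.neg + ξ 1 • u.pos

theorem comb_smul {n : ℕ} (u : Stiefel n) (a : ℂ) (ξ : Fin 2 → ℂ) :
    comb u (a • ξ) = a • comb u ξ := by
  simp only [comb, Pi.smul_apply, smul_eq_mul]
  module

theorem comb_add {n : ℕ} (u : Stiefel n) (ξ η : Fin 2 → ℂ) :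
    comb u (ξ + η) = comb u ξ + comb u η := by
  simp only [comb, Pi.add_apply]
  module

theorem herm_comb {n : ℕ} (u : Stiefel n) (ξ η : Fin 2 → ℂ) :
    herm (comb u ξ) (comb u η) = herm ξ η := by
  simp only [comb, herm_add_left, herm_add_right, herm_smul_left, herm_smul_right, u.herm_neg,
    u.herm_pos, u.herm_neg_pos, u.herm_pos_neg, herm_fin_two]
  ring

theorem comb_injective {n : ℕ} (u : Stiefel n) : Function.Injective (comb u) := by
  intro ξ η h
  have h0 := congrArg (fun x => herm x u.neg) h
  have h1 := congrArg (fun x => herm x u.pos) h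
  simp only [comb, herm_add_left, herm_smul_left, u.herm_neg, u.herm_pos, u.herm_neg_pos,
    u.herm_pos_neg] at h0 h1
  funext i
  fin_cases i
  · simp only [Fin.zero_eta]; linear_combination -h0
  · simp only [Fin.mk_one]; linear_combination h1

theorem comb_mem {n : ℕ} (u : Stiefel n) (ξ : Fin 2 → ℂ) : comb u ξ ∈ plane u := frame_mem u _ _

theorem mem_plane_iff {n : ℕ} (u : Stiefel n) (x : Fin (n + 1) → ℂ) :
    x ∈ plane u ↔ ∃ ξ, x = comb u ξ := by
  refine ⟨fun h => ?_, ?_⟩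
  · obtain ⟨a, b, h⟩ := Submodule.mem_span_pair.1 h
    exact ⟨![a, b], by simp [comb, h]⟩
  · rintro ⟨ξ, rfl⟩
    exact comb_mem u ξ

theorem gamma_coe {n : ℕ} (s : Kind) (u : Stiefel n) (r t : ℝ) :
    (gamma s u r t).1 = comb u (curveCoord s r t) := rfl

theorem hasDerivAt_comb {n : ℕ} (u : Stiefel n) {ξ : ℝ → Fin 2 → ℂ} {ξ' : Fin 2 → ℂ} {t : ℝ}
    (h : HasDerivAt ξ ξ' t) : HasDerivAt (fun τ => comb u (ξ τ)) (comb u ξ') t := by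
  have h := hasDerivAt_pi.1 h
  exact ((h 0).smul_const u.neg).add ((h 1).smul_const u.pos)

theorem hasDerivAt_oneParam_mulVec (s : Kind) (ξ : Fin 2 → ℂ) (t : ℝ) :
    HasDerivAt (fun τ => oneParam s τ *ᵥ ξ) (gen s *ᵥ (oneParam s t *ᵥ ξ)) t := by
  refine hasDerivAt_pi.2 fun i => ?_
  rw [Matrix.mulVec_mulVec]
  simp only [Matrix.mulVec, dotProduct, Fin.sum_univ_two]
  exact ((hasDerivAt_oneParam s i 0 t).mul_const _).add ((hasDerivAt_oneParam s i 1 t).mul_const _)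

theorem hasDerivAt_curveCoord (s : Kind) (r t : ℝ) :
    HasDerivAt (curveCoord s r) (gen s *ᵥ curveCoord s r t) t :=
  hasDerivAt_oneParam_mulVec s _ t

theorem gen_mulVec_oneParam_mulVec (s : Kind) (t : ℝ) (ξ : Fin 2 → ℂ) :
    gen s *ᵥ (oneParam s t *ᵥ ξ) = oneParam s t *ᵥ (gen s *ᵥ ξ) := by
  rw [Matrix.mulVec_mulVec, Matrix.mulVec_mulVec, oneParam_mul_gen]

theorem hasDerivAt_gen_curveCoord (s : Kind) (r t : ℝ) :
    HasDerivAt (fun τ => gen s *ᵥ curveCoord s r τ) ((genSq s : ℂ) • curveCoord s r t) t := by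
  have h := hasDerivAt_oneParam_mulVec s (gen s *ᵥ startVec s r) t
  simp only [curveCoord, gen_mulVec_oneParam_mulVec]
  refine h.congr_deriv ?_
  rw [gen_mulVec_oneParam_mulVec, Matrix.mulVec_mulVec _ (gen s), gen_mul_gen, Matrix.smul_mulVec,
    Matrix.one_mulVec, Matrix.mulVec_smul]

/-- The number `β` with `((γ', γ)) = i β` for `γ = γ_r^s`. -/
noncomputable def rotation : Kind → ℝ → ℝ
  | .plus, r => -Real.cosh (2 * r)
  | .minus, r => -Real.sinh (2 * r)
  | .zero, r => -Real.exp (2 * r)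

theorem herm_gen_startVec (s : Kind) (r : ℝ) :
    herm (gen s *ᵥ startVec s r) (startVec s r) = Complex.I * (rotation s r : ℂ) := by
  cases s
  · rw [herm_fin_two, rotation, Real.cosh_two_mul]
    simp [gen, startVec, Matrix.mulVec, dotProduct, Fin.sum_univ_two, Complex.conj_ofReal,
      -Complex.ofReal_cosh, -Complex.ofReal_sinh]
    ring
  · rw [herm_fin_two, rotation, Real.sinh_two_mul]
    simp [gen, startVec, Matrix.mulVec, dotProduct, Fin.sum_univ_two, Complex.conj_ofReal,
      -Complex.ofReal_cosh, -Complex.ofReal_sinh]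
    ring
  · rw [herm_fin_two, rotation, ← Real.cosh_add_sinh (2 * r), Real.cosh_two_mul, Real.sinh_two_mul]
    simp [gen, startVec, Matrix.mulVec, dotProduct, Fin.sum_univ_two, Complex.conj_ofReal,
      -Complex.ofReal_cosh, -Complex.ofReal_sinh]
    linear_combination Complex.I * Real.sinh r ^ 2 * Complex.I_mul_I

theorem herm_gen_gen (s : Kind) (ξ : Fin 2 → ℂ) :
    herm (gen s *ᵥ ξ) (gen s *ᵥ ξ) = -(genSq s : ℂ) * herm ξ ξ := by
  cases s <;> simp [herm_fin_two, gen, genSq, dotProduct, Fin.sum_univ_two]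
  · linear_combination (ξ 0 * conj (ξ 0) - ξ 1 * conj (ξ 1)) * Complex.I_mul_I
  · linear_combination (ξ 0 * conj (ξ 0) - ξ 1 * conj (ξ 1)) * Complex.I_mul_I

theorem herm_startVec (s : Kind) (r : ℝ) : herm (startVec s r) (startVec s r) = -1 := by
  have h := curveCoord_norm s r 0
  rw [curveCoord, oneParam_zero, Matrix.one_mulVec] at h
  rw [herm_fin_two, h]

theorem herm_gen_curveCoord (s : Kind) (r t : ℝ) :
    herm (gen s *ᵥ curveCoord s r t) (curveCoord s r t) = Complex.I * (rotation s r : ℂ) := by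
  rw [curveCoord, gen_mulVec_oneParam_mulVec, (isU11_oneParam s t).herm_mulVec, herm_gen_startVec]

theorem herm_gen_gen_curveCoord (s : Kind) (r t : ℝ) :
    herm (gen s *ᵥ curveCoord s r t) (gen s *ᵥ curveCoord s r t) = (genSq s : ℂ) := by
  rw [herm_gen_gen, curveCoord, (isU11_oneParam s t).herm_mulVec, herm_startVec]
  ring

/-! ### The curves `π₋ ∘ γ_r^s` -/

theorem isLift_curve {n : ℕ} (s : Kind) (u : Stiefel n) (r : ℝ) :
    IsLift (curve s u r) (gamma s u r) (fun t => comb u (gen s *ᵥ curveCoord s r t))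
      (fun t => (genSq s : ℂ) • (gamma s u r t).1) where
  hopf_eq _ := rfl
  hasDerivAt t := hasDerivAt_comb u (hasDerivAt_curveCoord s r t)
  hasDerivAt' t := by
    rw [gamma_coe, ← comb_smul]
    exact hasDerivAt_comb u (hasDerivAt_gen_curveCoord s r t)

theorem contDiff_oneParam (s : Kind) (i j : Fin 2) : ContDiff ℝ ∞ fun t => oneParam s t i j := by
  have h0 : ContDiff ℝ ∞ fun τ : ℝ => (τ : ℂ) := Complex.ofRealCLM.contDiff
  have h1 : ContDiff ℝ ∞ fun τ : ℝ => (τ : ℂ) * Complex.I := h0.mul contDiff_const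
  have hc : ContDiff ℝ ∞ fun τ : ℝ => ((Real.cosh τ : ℝ) : ℂ) :=
    Complex.ofRealCLM.contDiff.comp Real.contDiff_cosh
  have hs : ContDiff ℝ ∞ fun τ : ℝ => ((Real.sinh τ : ℝ) : ℂ) :=
    Complex.ofRealCLM.contDiff.comp Real.contDiff_sinh
  cases s <;> fin_cases i <;> fin_cases j <;> simp [oneParam, -Complex.ofReal_cosh,
    -Complex.ofReal_sinh]
  · exact h1.cexp
  · exact contDiff_const
  · exact contDiff_const
  · exact h1.neg.cexp
  · exact hc
  · exact hs
  · exact hs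
  · exact hc
  · exact contDiff_const.add h1
  · exact h0
  · exact h0
  · exact contDiff_const.sub h1

theorem contDiff_comb {n : ℕ} (u : Stiefel n) {ξ : ℝ → Fin 2 → ℂ}
    (h : ∀ i, ContDiff ℝ ∞ fun t => ξ t i) : ContDiff ℝ ∞ fun t => comb u (ξ t) :=
  ((h 0).smul contDiff_const).add ((h 1).smul contDiff_const)

theorem isSmoothCurve_curve {n : ℕ} (s : Kind) (u : Stiefel n) (r : ℝ) :
    IsSmoothCurve (curve s u r) := by
  refine isSmoothCurve_of_lift (w := gamma s u r) (fun _ => rfl) (contDiff_comb u fun i => ?_)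
  simp only [curveCoord, Matrix.mulVec, dotProduct, Fin.sum_univ_two]
  exact ((contDiff_oneParam s i 0).mul contDiff_const).add
    ((contDiff_oneParam s i 1).mul contDiff_const)

theorem speedSq_curve {n : ℕ} (s : Kind) (u : Stiefel n) (r t : ℝ) :
    speedSq (curve s u r) t = genSq s + rotation s r ^ 2 := by
  rw [(isLift_curve s u r).metric_velocity, gamma_coe, herm_comb, herm_comb,
    herm_gen_gen_curveCoord, herm_gen_curveCoord, Complex.mul_conj]
  simp [sq]

/-- The second derivative of the lift is vertical, so only $2((\gamma',\gamma))$ times the velocity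
remains, and this factor is purely imaginary. -/
theorem isAcceleration_curve {n : ℕ} (s : Kind) (u : Stiefel n) (r t : ℝ) :
    IsAcceleration (curve s u r) t
      ((Complex.I * ((2 * rotation s r : ℝ) : ℂ)) • velocity (curve s u r) t) := by
  have hL := isLift_curve s u r
  have h0 : dchart (gamma s u r t).1 (gamma s u r t).1 = 0 := by
    have := zero_ne_of_herm (gamma s u r t).2
    funext j
    simp [dchart, this]
  rw [hL.isAcceleration_iff, dchart_smul, h0, hL.velocity_eq, smul_zero, zero_add, gamma_coe,
    herm_comb, herm_gen_curveCoord]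
  congr 1
  push_cast
  ring

theorem metric_I_smul {n : ℕ} {z : Fin n → ℂ} (hz : 0 < defect z) (μ : ℝ) (X : Fin n → ℂ) :
    metric z ((Complex.I * (μ : ℂ)) • X) X = 0 := by
  rw [metric_eq hz, dotc_smul_left, dotc_smul_left, dotc_self, mul_assoc _ (dotc X z),
    Complex.mul_conj]
  simp

theorem metric_I_smul_I_smul {n : ℕ} {z : Fin n → ℂ} (hz : 0 < defect z) (μ : ℝ)
    (X : Fin n → ℂ) : metric z ((Complex.I * (μ : ℂ)) • X) ((Complex.I * (μ : ℂ)) • X) =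
      μ ^ 2 * metric z X X := by
  have h : ∀ a b : ℂ, (Complex.I * (μ : ℂ)) * a * (conj (Complex.I * (μ : ℂ)) * b) =
      ((μ ^ 2 : ℝ) : ℂ) * (a * b) := fun a b => by
    simp only [map_mul, Complex.conj_I, Complex.conj_ofReal]
    push_cast
    linear_combination (-(μ : ℂ) ^ 2 * a * b) * Complex.I_mul_I
  have h1 : Complex.I * (μ : ℂ) * (conj (Complex.I * (μ : ℂ)) * dotc X X) =
      ((μ ^ 2 : ℝ) : ℂ) * dotc X X := by
    simpa using h 1 (dotc X X)
  rw [metric_eq hz, metric_eq hz, dotc_smul_left, dotc_smul_left, dotc_smul_right, h1,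
    map_mul conj _ (dotc X z), h, Complex.re_ofReal_mul, Complex.re_ofReal_mul]
  ring

/-- A purely imaginary multiple of the velocity is orthogonal to the velocity, so the acceleration
is its own normal part and has length `|μ|` times the speed. -/
theorem hasCurvature_iff {n : ℕ} {c : ℝ → CH n} {t μ : ℝ} (hs : 0 < speedSq c t)
    (h : IsAcceleration c t ((Complex.I * (μ : ℂ)) • velocity c t)) (κ : ℝ) :
    HasCurvature c t κ ↔ κ = |μ| / Real.sqrt (speedSq c t) := by
  have hz := defect_pos (c t)
  have hv : velocity c t ≠ 0 := by
    intro h0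
    have : dotc (0 : Fin n → ℂ) 0 = 0 := by simp [dotc]
    have h1 : dotc (0 : Fin n → ℂ) (chart (c t)) = 0 := by simp [dotc]
    rw [speedSq, h0, metric_eq hz, this, h1] at hs
    simp at hs
  have hval : Real.sqrt (metric (chart (c t))
      (normalPart c t ((Complex.I * (μ : ℂ)) • velocity c t))
      (normalPart c t ((Complex.I * (μ : ℂ)) • velocity c t))) / speedSq c t =
      |μ| / Real.sqrt (speedSq c t) := by
    rw [normalPart, metric_I_smul hz, zero_div, zero_smul, sub_zero, metric_I_smul_I_smul hz]
    change Real.sqrt (μ ^ 2 * speedSq c t) / _ = _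
    rw [Real.sqrt_mul (sq_nonneg _), Real.sqrt_sq_eq_abs]
    conv_lhs => rw [← Real.mul_self_sqrt hs.le]
    have := (Real.sqrt_pos.2 hs).ne'
    field_simp
    rw [Real.sqrt_sq (Real.sqrt_nonneg _)]
  constructor
  · rintro ⟨_, V, hV, rfl⟩
    rw [isAcceleration_iff hz] at h hV
    rw [hV, ← h, hval]
  · intro e
    exact ⟨hv, _, h, by rw [hval, e]⟩

theorem speedSq_curve_pos {n : ℕ} (s : Kind) (u : Stiefel n) (r t : ℝ) (hr : AdmissibleRadius s r) :
    0 < speedSq (curve s u r) t := by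
  rw [speedSq_curve]
  cases s
  · have h1 : 1 < Real.cosh (2 * r) := Real.one_lt_cosh.2 (mul_ne_zero two_ne_zero hr)
    simp only [genSq, rotation]
    nlinarith
  · simp only [genSq, rotation]
    positivity
  · simp only [genSq, rotation]
    have := Real.exp_pos (2 * r)
    rw [zero_add, neg_sq]
    positivity

/-- The values are $2\coth|2r|$, $2\tanh|2r|$ and $2$ for $s=+,-,0$. -/
theorem admissibleCurvature_curve {s : Kind} {r : ℝ} (hr : AdmissibleRadius s r) :
    AdmissibleCurvature s (|2 * rotation s r| / Real.sqrt (genSq s + rotation s r ^ 2)) := by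
  rw [abs_mul, abs_two]
  cases s
  · have h1 : 1 < Real.cosh (2 * r) := Real.one_lt_cosh.2 (mul_ne_zero two_ne_zero hr)
    simp only [genSq, rotation, abs_neg, AdmissibleCurvature, neg_sq]
    have h2 : 0 < -1 + Real.cosh (2 * r) ^ 2 := by nlinarith
    rw [abs_of_pos (by linarith), lt_div_iff₀ (Real.sqrt_pos.2 h2)]
    have : Real.sqrt (-1 + Real.cosh (2 * r) ^ 2) < Real.cosh (2 * r) :=
      (Real.sqrt_lt' (by linarith)).2 (by linarith)
    linarith
  · simp only [genSq, rotation, abs_neg, AdmissibleCurvature, neg_sq]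
    have h2 : 0 < 1 + Real.sinh (2 * r) ^ 2 := by positivity
    refine ⟨by positivity, ?_⟩
    rw [div_lt_iff₀ (Real.sqrt_pos.2 h2)]
    have : |Real.sinh (2 * r)| < Real.sqrt (1 + Real.sinh (2 * r) ^ 2) :=
      Real.lt_sqrt_of_sq_lt (by rw [sq_abs]; linarith)
    linarith
  · simp only [genSq, rotation, abs_neg, AdmissibleCurvature, neg_sq, zero_add]
    rw [Real.sqrt_sq (Real.exp_pos _).le, abs_of_pos (Real.exp_pos _)]
    have := (Real.exp_pos (2 * r)).ne'
    field_simp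

theorem hasCurvature_curve {n : ℕ} (s : Kind) (u : Stiefel n) (r t : ℝ)
    (hr : AdmissibleRadius s r) : HasCurvature (curve s u r) t
      (|2 * rotation s r| / Real.sqrt (genSq s + rotation s r ^ 2)) := by
  rw [hasCurvature_iff (speedSq_curve_pos s u r t hr) (isAcceleration_curve s u r t), speedSq_curve]

theorem curveFamily_subset {n : ℕ} (s : Kind) (u : Stiefel n) (r : ℝ) :
    curveFamily s u r ⊆ hyperbolicLine (plane u) := by
  rintro _ ⟨t, rfl⟩
  exact ⟨gamma s u r t, comb_mem u _, rfl⟩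

/-! ### The orthogonal geodesics -/

/-- The derivative of `startVec s r` in `r`. -/
noncomputable def startVec' : Kind → ℝ → Fin 2 → ℂ
  | .plus, r => ![(Real.sinh r : ℂ), (Real.cosh r : ℂ)]
  | .minus, r => ![(Real.sinh r : ℂ), Complex.I * (Real.cosh r : ℂ)]
  | .zero, r => ![(Real.sinh r : ℂ), Complex.I * (Real.cosh r : ℂ)]

theorem hasDerivAt_startVec (s : Kind) (r : ℝ) : HasDerivAt (startVec s) (startVec' s r) r := by
  have hc := hasDerivAt_ofReal_cosh r
  have hs := hasDerivAt_ofReal_sinh r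
  refine hasDerivAt_pi.2 fun i => ?_
  cases s <;> fin_cases i <;> simp [startVec, startVec', -Complex.ofReal_cosh,
    -Complex.ofReal_sinh]
  exacts [hc, hs, hc, hs.const_mul _, hc, hs.const_mul _]

theorem hasDerivAt_startVec' (s : Kind) (r : ℝ) : HasDerivAt (startVec' s) (startVec s r) r := by
  have hc := hasDerivAt_ofReal_cosh r
  have hs := hasDerivAt_ofReal_sinh r
  refine hasDerivAt_pi.2 fun i => ?_
  cases s <;> fin_cases i <;> simp [startVec, startVec', -Complex.ofReal_cosh,
    -Complex.ofReal_sinh]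
  exacts [hs, hc, hs, hc.const_mul _, hs, hc.const_mul _]

theorem hasDerivAt_mulVec (h : Matrix (Fin 2) (Fin 2) ℂ) {ξ : ℝ → Fin 2 → ℂ} {ξ' : Fin 2 → ℂ}
    {t : ℝ} (hξ : HasDerivAt ξ ξ' t) : HasDerivAt (fun τ => h *ᵥ ξ τ) (h *ᵥ ξ') t := by
  have hξ := hasDerivAt_pi.1 hξ
  refine hasDerivAt_pi.2 fun i => ?_
  simp only [Matrix.mulVec, dotProduct, Fin.sum_univ_two]
  exact ((hξ 0).const_mul _).add ((hξ 1).const_mul _)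

theorem isLift_radial {n : ℕ} (s : Kind) (u : Stiefel n) (t : ℝ) :
    IsLift (fun r => curve s u r t) (fun r => gamma s u r t)
      (fun r => comb u (oneParam s t *ᵥ startVec' s r)) (fun r => (gamma s u r t).1) where
  hopf_eq _ := rfl
  hasDerivAt r := hasDerivAt_comb u (hasDerivAt_mulVec _ (hasDerivAt_startVec s r))
  hasDerivAt' r := hasDerivAt_comb u (hasDerivAt_mulVec _ (hasDerivAt_startVec' s r))

theorem herm_startVec'_startVec (s : Kind) (r : ℝ) : herm (startVec' s r) (startVec s r) = 0 := by
  cases s <;> simp [herm_fin_two, startVec, startVec', -Complex.ofReal_cosh, -Complex.ofReal_sinh]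
  · ring
  · linear_combination -(Real.cosh r * Real.sinh r : ℂ) * Complex.I_mul_I
  · linear_combination -(Real.cosh r * Real.sinh r : ℂ) * Complex.I_mul_I

theorem herm_startVec'_startVec' (s : Kind) (r : ℝ) :
    herm (startVec' s r) (startVec' s r) = 1 := by
  have hc : (Real.cosh r : ℂ) ^ 2 = (Real.sinh r : ℂ) ^ 2 + 1 := by
    exact_mod_cast Real.cosh_sq r
  cases s <;> simp [herm_fin_two, startVec', -Complex.ofReal_cosh, -Complex.ofReal_sinh]
  · linear_combination hc
  · linear_combination hc - (Real.cosh r : ℂ) ^ 2 * Complex.I_mul_I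
  · linear_combination hc - (Real.cosh r : ℂ) ^ 2 * Complex.I_mul_I

theorem re_herm_startVec'_gen (s : Kind) (r : ℝ) :
    (herm (startVec' s r) (gen s *ᵥ startVec s r)).re = 0 := by
  cases s <;> simp [herm_fin_two, gen, startVec, startVec', -Complex.ofReal_cosh, -Complex.ofReal_sinh]

/-- For fixed `t` the lift is horizontal and equals its own second derivative, so both terms of the
acceleration vanish. Unit speed and orthogonality are invariant under `oneParam s t`, which reduces
them to identities for `startVec`. -/
theorem isParallelFamily_curve {n : ℕ} (s : Kind) (u : Stiefel n) :
    IsParallelFamily (curve s u) := by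
  have hw : ∀ r t, herm (comb u (oneParam s t *ᵥ startVec' s r)) (gamma s u r t).1 = 0 :=
    fun r t => by
      rw [gamma_coe, herm_comb, curveCoord, (isU11_oneParam s t).herm_mulVec,
        herm_startVec'_startVec]
  refine ⟨fun t => ⟨⟨?_, fun r => ?_⟩, fun r => ?_⟩, fun r t => ?_⟩
  · refine isSmoothCurve_of_lift (w := fun r => gamma s u r t) (fun _ => rfl)
      (contDiff_comb u fun i => ?_)
    have hst : ∀ i, ContDiff ℝ ∞ fun r => startVec s r i := fun i => by
      have hc : ContDiff ℝ ∞ fun τ : ℝ => ((Real.cosh τ : ℝ) : ℂ) :=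
        Complex.ofRealCLM.contDiff.comp Real.contDiff_cosh
      have hs : ContDiff ℝ ∞ fun τ : ℝ => ((Real.sinh τ : ℝ) : ℂ) :=
        Complex.ofRealCLM.contDiff.comp Real.contDiff_sinh
      cases s <;> fin_cases i <;> simp [startVec, -Complex.ofReal_cosh, -Complex.ofReal_sinh]
      exacts [hc, hs, hc, contDiff_const.mul hs, hc, contDiff_const.mul hs]
    simp only [curveCoord, Matrix.mulVec, dotProduct, Fin.sum_univ_two]
    exact (contDiff_const.mul (hst 0)).add (contDiff_const.mul (hst 1))
  · have h0 : dchart (gamma s u r t).1 (gamma s u r t).1 = 0 := by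
      have := zero_ne_of_herm (gamma s u r t).2
      funext j
      simp [dchart, this]
    rw [(isLift_radial s u t).isAcceleration_iff, hw, h0]
    simp
  · rw [(isLift_radial s u t).metric_velocity, hw, herm_comb, (isU11_oneParam s t).herm_mulVec,
      herm_startVec'_startVec']
    simp
  · rw [(isLift_radial s u t).velocity_eq, (isLift_curve s u r).velocity_eq, curve, metric_dchart,
      hw, herm_comb, curveCoord, gen_mulVec_oneParam_mulVec, (isU11_oneParam s t).herm_mulVec,
      zero_mul, add_zero, re_herm_startVec'_gen]

/-! ### Change of frame -/

theorem Stiefel.ext' {n : ℕ} {u v : Stiefel n} (h : u.neg = v.neg) (h' : u.pos = v.pos) :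
    u = v := by
  cases u
  cases v
  cases h
  cases h'
  rfl

theorem mulNeg_eq_comb {n : ℕ} (u : Stiefel n) (h : Matrix (Fin 2) (Fin 2) ℂ) :
    mulNeg u h = comb u (h *ᵥ ![1, 0]) := by
  simp [mulNeg, comb, Matrix.mulVec, dotProduct]

theorem mulPos_eq_comb {n : ℕ} (u : Stiefel n) (h : Matrix (Fin 2) (Fin 2) ℂ) :
    mulPos u h = comb u (h *ᵥ ![0, 1]) := by
  simp [mulPos, comb, Matrix.mulVec, dotProduct]

/-- The frame `(u₋, u₊) h`, for `h` in `U(1,1)`. -/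
noncomputable def Stiefel.mul {n : ℕ} (u : Stiefel n) (h : Matrix (Fin 2) (Fin 2) ℂ)
    (hh : IsU11 h) : Stiefel n where
  neg := mulNeg u h
  pos := mulPos u h
  herm_neg := by
    rw [mulNeg_eq_comb, herm_comb, hh.herm_mulVec]
    simp [herm_fin_two]
  herm_pos := by
    rw [mulPos_eq_comb, herm_comb, hh.herm_mulVec]
    simp [herm_fin_two]
  herm_neg_pos := by
    rw [mulPos_eq_comb, mulNeg_eq_comb, herm_comb, hh.herm_mulVec]
    simp [herm_fin_two]

theorem comb_mul {n : ℕ} (u : Stiefel n) {h : Matrix (Fin 2) (Fin 2) ℂ} (hh : IsU11 h)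
    (ξ : Fin 2 → ℂ) : comb (u.mul h hh) ξ = comb u (h *ᵥ ξ) := by
  simp only [comb, Stiefel.mul, mulNeg, mulPos, Matrix.mulVec, dotProduct, Fin.sum_univ_two]
  module

theorem IsU11.exists_inverse {h : Matrix (Fin 2) (Fin 2) ℂ} (hh : IsU11 h) :
    ∃ h' : Matrix (Fin 2) (Fin 2) ℂ, IsU11 h' ∧ h * h' = 1 ∧ h' * h = 1 := by
  -- The adjoint of `h` for the form of signature (1,1). The other product `h * h' = 1` then gives
  -- the relations that put `h'` in $U(1,1)$.
  set h' : Matrix (Fin 2) (Fin 2) ℂ :=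
    !![conj (h 0 0), -conj (h 1 0); -conj (h 0 1), conj (h 1 1)] with hdef
  have h1 : h' * h = 1 := by
    ext i j
    fin_cases i <;> fin_cases j <;> simp [hdef, Matrix.mul_apply, Fin.sum_univ_two]
    · linear_combination -hh.neg_neg
    · linear_combination -hh.pos_neg
    · linear_combination hh.neg_pos
    · linear_combination hh.pos_pos
  have h2 : h * h' = 1 := mul_eq_one_comm.1 h1
  have h00 := congrFun (congrFun h2 0) 0
  have h10 := congrFun (congrFun h2 1) 0
  have h11 := congrFun (congrFun h2 1) 1
  simp [hdef, Matrix.mul_apply, Fin.sum_univ_two] at h00 h10 h11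
  refine ⟨h', ⟨?_, ?_, ?_⟩, h2, h1⟩ <;> simp [hdef]
  · linear_combination -h00
  · linear_combination h11
  · linear_combination h10

theorem plane_mul {n : ℕ} (u : Stiefel n) {h : Matrix (Fin 2) (Fin 2) ℂ} (hh : IsU11 h) :
    plane (u.mul h hh) = plane u := by
  obtain ⟨h', -, h1, -⟩ := hh.exists_inverse
  ext x
  rw [mem_plane_iff, mem_plane_iff]
  constructor
  · rintro ⟨ξ, rfl⟩
    exact ⟨_, comb_mul u hh ξ⟩
  · rintro ⟨ξ, rfl⟩
    refine ⟨h' *ᵥ ξ, ?_⟩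
    rw [comb_mul, Matrix.mulVec_mulVec, h1, Matrix.one_mulVec]

theorem exists_eq_mul {n : ℕ} {u v : Stiefel n} (hn : v.neg ∈ plane u) (hp : v.pos ∈ plane u) :
    ∃ (h : Matrix (Fin 2) (Fin 2) ℂ) (hh : IsU11 h), v = u.mul h hh := by
  obtain ⟨ξ, hξ⟩ := (mem_plane_iff u _).1 hn
  obtain ⟨η, hη⟩ := (mem_plane_iff u _).1 hp
  have h1 := v.herm_neg
  have h2 := v.herm_pos
  have h3 := v.herm_neg_pos
  rw [hξ, herm_comb, herm_fin_two] at h1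
  rw [hη, herm_comb, herm_fin_two] at h2
  rw [hξ, hη, herm_comb, herm_fin_two] at h3
  exact ⟨!![ξ 0, η 0; ξ 1, η 1], ⟨h1, h2, h3⟩, Stiefel.ext' hξ hη⟩

theorem plane_eq_of_mem {n : ℕ} {u v : Stiefel n} (hn : v.neg ∈ plane u) (hp : v.pos ∈ plane u) :
    plane v = plane u := by
  obtain ⟨h, hh, rfl⟩ := exists_eq_mul hn hp
  exact plane_mul u hh

theorem eq_of_mem_plane {n : ℕ} (u : Stiefel n) {x : Fin (n + 1) → ℂ} (hx : x ∈ plane u) :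
    x = -herm x u.neg • u.neg + herm x u.pos • u.pos := by
  obtain ⟨ξ, rfl⟩ := (mem_plane_iff u x).1 hx
  simp only [comb, herm_add_left, herm_smul_left, u.herm_neg, u.herm_pos, u.herm_neg_pos,
    u.herm_pos_neg]
  module

/-! ### Horizontal lifts -/

theorem hasDerivAt_herm {n : ℕ} {x y : ℝ → Fin (n + 1) → ℂ} {x' y' : Fin (n + 1) → ℂ} {t : ℝ}
    (hx : HasDerivAt x x' t) (hy : HasDerivAt y y' t) :
    HasDerivAt (fun τ => herm (x τ) (y τ)) (herm x' (y t) + herm (x t) y') t := by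
  have hx := hasDerivAt_pi.1 hx
  have hy : ∀ i, HasDerivAt (fun τ => conj (y τ i)) (conj (y' i)) t := fun i =>
    (hasDerivAt_pi.1 hy i).star
  have h := ((hx 0).mul (hy 0)).neg.add
    (HasDerivAt.fun_sum (u := Finset.univ) fun j _ => (hx (Fin.succ j)).mul (hy (Fin.succ j)))
  refine h.congr_deriv ?_
  simp only [herm, Finset.sum_add_distrib]
  ring

theorem continuous_herm {n : ℕ} {x y : ℝ → Fin (n + 1) → ℂ} (hx : Continuous x)
    (hy : Continuous y) : Continuous fun t => herm (x t) (y t) := by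
  unfold herm
  have := fun j => (continuous_apply j).comp hx
  have := fun j => (continuous_apply j).comp hy
  fun_prop

theorem contDiff_dotc {n : ℕ} {x y : ℝ → Fin n → ℂ} (hx : ContDiff ℝ ∞ x)
    (hy : ContDiff ℝ ∞ y) : ContDiff ℝ ∞ fun t => dotc (x t) (y t) := by
  unfold dotc
  refine ContDiff.sum fun j _ => ((contDiff_pi.1 hx) j).mul ?_
  exact Complex.conjCLE.contDiff.comp ((contDiff_pi.1 hy) j)

/-- A multiple $f\cdot(1,z)$ of the section given by the chart is horizontal when $f'=gf$ with
$g=\langle z',z\rangle/(1-|z|^2)$. Horizontality makes $((w,w))$ constant, so its value need only be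
fixed at time zero. -/
theorem exists_horizontal_lift {n : ℕ} {c : ℝ → CH n} (hc : IsSmoothCurve c) :
    ∃ (w : ℝ → AntiDeSitter n) (w₁ w₂ : ℝ → Fin (n + 1) → ℂ), IsLift c w w₁ w₂ ∧
      (∀ t, herm (w₁ t) (w t).1 = 0) ∧ Continuous w₂ := by
  have hD : ∀ t, (defect (chart (c t)) : ℂ) ≠ 0 := fun t => by
    exact_mod_cast (defect_pos (c t)).ne'
  have hz : ContDiff ℝ ∞ fun t => chart (c t) := hc
  have hV := hc.contDiff_velocity
  set g : ℝ → ℂ := fun t => dotc (velocity c t) (chart (c t)) / (defect (chart (c t)) : ℂ) with hg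
  have hgs : ContDiff ℝ ∞ g := by
    simp only [hg, div_eq_mul_inv]
    refine (contDiff_dotc hV hz).mul (ContDiff.inv ?_ hD)
    simp only [defect_coe]
    exact contDiff_const.sub (contDiff_dotc hz hz)
  set F : ℝ → ℂ := fun t => ∫ τ in (0 : ℝ)..t, g τ with hF
  have hFd : ∀ t, HasDerivAt F (g t) t := fun t =>
    intervalIntegral.integral_hasDerivAt_right (hgs.continuous.intervalIntegrable _ _)
      hgs.continuous.aestronglyMeasurable.stronglyMeasurableAtFilter hgs.continuous.continuousAt
  have hFs : ContDiff ℝ ∞ F := by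
    refine contDiff_infty_iff_deriv.2 ⟨fun t => (hFd t).differentiableAt, ?_⟩
    rwa [show deriv F = g from funext fun t => (hFd t).deriv]
  -- The constant normalizes $((W,W))$ to $-1$ at $t=0$.
  set f : ℝ → ℂ := fun t => ((Real.sqrt (defect (chart (c 0))))⁻¹ : ℝ) * Complex.exp (F t) with hf
  have hfd : ∀ t, HasDerivAt f (f t * g t) t := fun t =>
    ((hFd t).cexp.const_mul _).congr_deriv (by simp only [hf]; ring)
  have hfs : ContDiff ℝ ∞ f := contDiff_const.mul hFs.cexp
  set W : ℝ → Fin (n + 1) → ℂ := fun t => f t • (Fin.cons 1 (chart (c t)) : Fin (n + 1) → ℂ)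
    with hW
  have hWs : ContDiff ℝ ∞ W := by
    refine hfs.smul (contDiff_pi.2 fun j => Fin.cases ?_ (fun i => ?_) j)
    · simpa using contDiff_const
    · simpa using contDiff_pi.1 hz i
  have hWd : ∀ t, HasDerivAt W (deriv W t) t := fun t =>
    (hWs.differentiable (by simp) t).hasDerivAt
  have hWs' : ContDiff ℝ ∞ (deriv W) := (contDiff_infty_iff_deriv.1 hWs).2
  have hWs'' : ContDiff ℝ ∞ (deriv (deriv W)) := (contDiff_infty_iff_deriv.1 hWs').2
  have hhor : ∀ t, herm (deriv W t) (W t) = 0 := fun t => by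
    have h := ((hfd t).smul (hasDerivAt_cons (a := 1) (hc.hasDerivAt t))).deriv
    have h' : deriv W t = f t • (Fin.cons 0 (velocity c t) : Fin (n + 1) → ℂ) +
        (f t * g t) • (Fin.cons 1 (chart (c t)) : Fin (n + 1) → ℂ) := h
    have hd : dotc (chart (c t)) (chart (c t)) = 1 - (defect (chart (c t)) : ℂ) := by
      rw [defect_coe]; ring
    rw [h', hW]
    simp only [herm_add_left, herm_smul_left, herm_smul_right, herm_cons, hd, hg, map_one,
      mul_one, neg_zero]
    field_simp [hD t]
    ring
  have hnorm : ∀ t, herm (W t) (W t) = -1 := fun t => by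
    have hd : ∀ t, HasDerivAt (fun τ => herm (W τ) (W τ)) 0 t := fun t => by
      refine (hasDerivAt_herm (hWd t) (hWd t)).congr_deriv ?_
      rw [← herm_conj _ (W t), hhor, map_zero, add_zero]
    rw [is_const_of_deriv_eq_zero (fun t => (hd t).differentiableAt) (fun t => (hd t).deriv) t 0]
    have hs : ((Real.sqrt (defect (chart (c 0))) : ℂ))⁻¹ *
        ((Real.sqrt (defect (chart (c 0))) : ℂ))⁻¹ = (defect (chart (c 0)) : ℂ)⁻¹ := by
      rw [← mul_inv, ← Complex.ofReal_mul, Real.mul_self_sqrt (defect_pos _).le]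
    have hd' : dotc (chart (c 0)) (chart (c 0)) = 1 - (defect (chart (c 0)) : ℂ) := by
      rw [defect_coe]; ring
    have hF0 : F 0 = 0 := by simp [hF]
    simp only [hW, hf, hF0, Complex.exp_zero, mul_one]
    rw [herm_smul_left, herm_smul_right, herm_cons, hd', Complex.conj_ofReal, ← mul_assoc,
      Complex.ofReal_inv, hs]
    field_simp [hD 0]
    simp only [map_one]
    ring
  refine ⟨fun t => ⟨W t, hnorm t⟩, deriv W, deriv (deriv W), ⟨fun t => ?_, hWd, fun t =>
    (hWs'.differentiable (by simp) t).hasDerivAt⟩, hhor, hWs''.continuous⟩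
  obtain ⟨p, hp⟩ := hopf_surjective (c t)
  rw [← hp]
  refine hopf_eq_of_smul (a := f t / p.1 0) ?_
  have h0 := zero_ne_of_herm p.2
  have e := eq_smul_cons_chart p
  rw [hp] at e
  calc f t • (Fin.cons 1 (chart (c t)) : Fin (n + 1) → ℂ)
      = (f t / p.1 0) • p.1 0 • (Fin.cons 1 (chart (c t)) : Fin (n + 1) → ℂ) := by
        rw [smul_smul, div_mul_cancel₀ _ h0]
    _ = _ := by rw [← e]

/-! ### Curves of constant curvature in a complex hyperbolic line -/

theorem eq_of_second_order {n : ℕ} {μ : ℂ} {w w₁ W W₁ : ℝ → Fin (n + 1) → ℂ}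
    (hw : ∀ t, HasDerivAt w (w₁ t) t) (hw₁ : ∀ t, HasDerivAt w₁ (w t + μ • w₁ t) t)
    (hW : ∀ t, HasDerivAt W (W₁ t) t) (hW₁ : ∀ t, HasDerivAt W₁ (W t + μ • W₁ t) t)
    (h0 : w 0 = W 0) (h1 : w₁ 0 = W₁ 0) : w = W := by
  let E := Fin (n + 1) → ℂ
  let L : E × E →L[ℂ] E × E := (ContinuousLinearMap.snd ℂ E E).prod
    (ContinuousLinearMap.fst ℂ E E + μ • ContinuousLinearMap.snd ℂ E E)
  have h := ODE_solution_unique_univ (v := fun _ => L) (s := fun _ => Set.univ) (t₀ := 0)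
    (f := fun t => (w t, w₁ t)) (g := fun t => (W t, W₁ t))
    (fun _ => L.lipschitz.lipschitzOnWith)
    (fun t => ⟨(hw t).prodMk (hw₁ t), trivial⟩) (fun t => ⟨(hW t).prodMk (hW₁ t), trivial⟩)
    (by rw [h0, h1])
  funext t
  exact congrArg Prod.fst (congrFun h t)

/-- The two equations on `r` and `a` are exactly what makes $e^{i\lambda t}\gamma_r^s(at)$,
$\lambda=a\beta$, a solution of $w''=w+ikw'$ with unit speed. -/
theorem exists_radius {s : Kind} {κ k : ℝ} (h : AdmissibleCurvature s κ) (hk : κ = |k|) :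
    ∃ r a : ℝ, AdmissibleRadius s r ∧ a ≠ 0 ∧ 2 * (a * rotation s r) = k ∧
      a ^ 2 * (genSq s + rotation s r ^ 2) = 1 := by
  have hsq := sq_abs k
  rw [← hk] at hsq
  cases s
  · replace h : 2 < κ := h
    have hpos : 0 < k ^ 2 - 4 := by rw [← hsq]; nlinarith
    have hk0 : k ≠ 0 := by
      rintro rfl
      norm_num at hpos
    have hq : 0 < Real.sqrt (k ^ 2 - 4) := Real.sqrt_pos.2 hpos
    have hs : 2 * (Real.arsinh (2 / Real.sqrt (k ^ 2 - 4)) / 2) =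
        Real.arsinh (2 / Real.sqrt (k ^ 2 - 4)) := by ring
    have hc := Real.cosh_sq (Real.arsinh (2 / Real.sqrt (k ^ 2 - 4)))
    rw [Real.sinh_arsinh, div_pow, Real.sq_sqrt hpos.le] at hc
    have hcp := Real.cosh_pos (Real.arsinh (2 / Real.sqrt (k ^ 2 - 4)))
    -- From $2\coth 2r=|k|$ one gets $\sinh 2r=2/\sqrt{k^2-4}$; here $r>0$ and the sign of `k` goes
    -- into `a`.
    refine ⟨Real.arsinh (2 / Real.sqrt (k ^ 2 - 4)) / 2,
      -k / (2 * Real.cosh (Real.arsinh (2 / Real.sqrt (k ^ 2 - 4)))), ?_, ?_, ?_, ?_⟩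
    · have : 0 < Real.arsinh (2 / Real.sqrt (k ^ 2 - 4)) :=
        Real.arsinh_pos_iff.2 (div_pos two_pos hq)
      exact (half_pos this).ne'
    · exact div_ne_zero (neg_ne_zero.2 hk0) (mul_pos two_pos hcp).ne'
    · rw [rotation, hs]
      field_simp
    · rw [rotation, hs, genSq, div_pow, mul_pow, neg_sq, neg_sq, hc]
      field_simp
      ring
  · obtain ⟨h0, h2⟩ : 0 ≤ κ ∧ κ < 2 := h
    have hpos : 0 < 4 - k ^ 2 := by rw [← hsq]; nlinarith
    have hq : 0 < Real.sqrt (4 - k ^ 2) := Real.sqrt_pos.2 hpos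
    -- Here $a=1/\cosh 2r>0$, and the sign of `k` goes into `r`.
    refine ⟨Real.arsinh (-(k / Real.sqrt (4 - k ^ 2))) / 2, Real.sqrt (4 - k ^ 2) / 2, trivial,
      (half_pos hq).ne', ?_, ?_⟩
    · rw [rotation, mul_div_cancel₀ _ two_ne_zero, Real.sinh_arsinh]
      field_simp
    · rw [rotation, mul_div_cancel₀ _ two_ne_zero, Real.sinh_arsinh, genSq, neg_neg, div_pow,
        div_pow, Real.sq_sqrt hpos.le]
      field_simp
      ring
  · replace h : κ = 2 := h
    rw [h] at hsq
    -- For horocycles every radius would do; with `r = 0` one has `a = ±1`.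
    refine ⟨0, -k / 2, trivial, ?_, ?_, ?_⟩
    · intro h0
      have : k = 0 := by linarith
      rw [this] at hsq
      norm_num at hsq
    · simp [rotation]
      ring
    · rw [rotation, genSq, mul_zero, Real.exp_zero]
      linarith

/-- A Frenet argument in the plane: the horizontal lift and its derivative form a moving frame, the
Frenet equation is linear with constant coefficients, and uniqueness of solutions identifies the
lift with a rotated model curve. -/
theorem exists_curve_of_hasCurvature {n : ℕ} {s : Kind} (v : Stiefel n) {κ : ℝ}
    (hκ : AdmissibleCurvature s κ) {c : ℝ → CH n} (hc : IsSmoothCurve c)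
    (hspeed : ∀ t, speedSq c t = 1) (hline : ∀ t, c t ∈ hyperbolicLine (plane v))
    (hcurv : ∀ t, HasCurvature c t κ) :
    ∃ (u : Stiefel n) (r a : ℝ), plane u = plane v ∧ AdmissibleRadius s r ∧ a ≠ 0 ∧
      ∀ t, c t = curve s u r (a * t) := by
  obtain ⟨w, w₁, w₂, hL, hhor, hw₂⟩ := exists_horizontal_lift hc
  have hP : ∀ t, (w t).1 ∈ plane v := fun t => by
    rw [← mem_hyperbolicLine_iff, ← hL.hopf_eq]
    exact hline t
  have hP₁ : ∀ t, w₁ t ∈ plane v := fun t => mem_of_hasDerivAt (hL.hasDerivAt t) hP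
  have hP₂ : ∀ t, w₂ t ∈ plane v := fun t => mem_of_hasDerivAt (hL.hasDerivAt' t) hP₁
  have h11 : ∀ t, herm (w₁ t) (w₁ t) = 1 := fun t => by
    have h := hL.metric_velocity t
    rw [hspeed, hhor, zero_mul, add_zero] at h
    rw [← Complex.conj_eq_iff_re.1 (herm_conj (w₁ t) (w₁ t)), ← h, Complex.ofReal_one]
  have h01 : ∀ t, herm (w t).1 (w₁ t) = 0 := fun t => by
    rw [← herm_conj, hhor, map_zero]
  have h20 : ∀ t, herm (w₂ t) (w t).1 = -1 := fun t => by
    have h := hasDerivAt_herm (hL.hasDerivAt' t) (hL.hasDerivAt t)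
    have h' := h.unique ((hasDerivAt_const t (0 : ℂ)).congr_of_eventuallyEq
      (Filter.Eventually.of_forall hhor))
    rw [h11] at h'
    exact eq_neg_of_add_eq_zero_left h'
  set k : ℝ → ℝ := fun t => (herm (w₂ t) (w₁ t)).im with hk
  have h21 : ∀ t, herm (w₂ t) (w₁ t) = Complex.I * (k t : ℂ) := fun t => by
    have h := hasDerivAt_herm (hL.hasDerivAt' t) (hL.hasDerivAt' t)
    have h' := h.unique ((hasDerivAt_const t (1 : ℂ)).congr_of_eventuallyEq
      (Filter.Eventually.of_forall h11))
    rw [← herm_conj (w₂ t)] at h'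
    have h'' := congrArg Complex.re h'
    simp only [Complex.add_re, Complex.conj_re, Complex.zero_re] at h''
    apply Complex.ext
    · simp
      linarith
    · simp [hk]
  let U : ℝ → Stiefel n := fun t => ⟨(w t).1, w₁ t, (w t).2, h11 t, h01 t⟩
  have hUP : ∀ t, plane (U t) = plane v := fun t => plane_eq_of_mem (hP t) (hP₁ t)
  -- The coefficients of `w₂` in the frame `(w, w₁)` come from differentiating $((w_1,w))=0$ and
  -- $((w_1,w_1))=1$.
  have hw2 : ∀ t, w₂ t = (w t).1 + (Complex.I * (k t : ℂ)) • w₁ t := fun t => by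
    have h := eq_of_mem_plane (U t) (x := w₂ t) (by rw [hUP]; exact hP₂ t)
    simp only [U, h20, h21, neg_neg, one_smul] at h
    exact h
  have habs : ∀ t, κ = |k t| := fun t => by
    have hacc : IsAcceleration c t ((Complex.I * (k t : ℂ)) • velocity c t) := by
      have h0 : dchart (w t).1 (w t).1 = 0 := by
        have := zero_ne_of_herm (w t).2
        funext j
        simp [dchart, this]
      rw [hL.isAcceleration_iff, hhor, hw2, dchart_add, dchart_smul, h0, hL.velocity_eq]
      simp
    have h := (hasCurvature_iff (by rw [hspeed]; exact one_pos) hacc κ).1 (hcurv t)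
    rwa [hspeed, Real.sqrt_one, div_one] at h
  have hkc : Continuous k := by
    refine Complex.continuous_im.comp (continuous_herm hw₂ ?_)
    exact continuous_iff_continuousAt.2 fun t => (hL.hasDerivAt' t).continuousAt
  -- The signed curvature is continuous with constant absolute value, so it cannot change sign; the
  -- case `κ = 0` is separate.
  have hconst : ∀ t, k t = k 0 := by
    rcases eq_or_ne κ 0 with h0 | h0
    · intro t
      rw [abs_eq_zero.1 ((habs t).symm.trans h0), abs_eq_zero.1 ((habs 0).symm.trans h0)]
    · have h := isPreconnected_univ.eq_or_eq_neg_of_sq_eq (f := k) (g := fun _ => κ)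
        hkc.continuousOn continuousOn_const
        (fun t _ => by simp only [Pi.pow_apply]; rw [habs t, sq_abs]) (fun _ => h0)
      rcases h with h | h
      · exact fun t => (h (Set.mem_univ t)).trans (h (Set.mem_univ 0)).symm
      · exact fun t => (h (Set.mem_univ t)).trans (h (Set.mem_univ 0)).symm
  obtain ⟨r, a, hr, ha, hka, hnorm⟩ := exists_radius hκ (habs 0)
  -- This phase speed makes $e^{i\lambda t}\gamma_r^s(at)$ horizontal; `x` and `y` are the
  -- coordinates of its position and velocity at `t = 0`.
  set lam : ℝ := a * rotation s r with hlam
  set x := startVec s r with hx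
  set y : Fin 2 → ℂ := (Complex.I * (lam : ℂ)) • x + (a : ℂ) • (gen s *ᵥ x) with hy
  have hxx : herm x x = -1 := herm_startVec s r
  have hNx : herm (gen s *ᵥ x) x = Complex.I * (rotation s r : ℂ) := herm_gen_startVec s r
  have hxN : herm x (gen s *ᵥ x) = -(Complex.I * (rotation s r : ℂ)) := by
    rw [← herm_conj, hNx, map_mul, Complex.conj_I, Complex.conj_ofReal]
    ring
  have hNN : herm (gen s *ᵥ x) (gen s *ᵥ x) = (genSq s : ℂ) := by
    rw [herm_gen_gen, hxx]
    ring
  have hnormC : (a : ℂ) ^ 2 * ((genSq s : ℂ) + (rotation s r : ℂ) ^ 2) = 1 := by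
    exact_mod_cast hnorm
  have hlamC : (lam : ℂ) = a * rotation s r := by rw [hlam]; push_cast; rfl
  have hxy : herm x y = 0 := by
    rw [hy, herm_add_right, herm_smul_right, herm_smul_right, hxx, hxN, map_mul, Complex.conj_I,
      Complex.conj_ofReal, Complex.conj_ofReal, hlamC]
    ring
  have hyy : herm y y = 1 := by
    rw [hy, herm_add_right, herm_add_left, herm_add_left]
    simp only [herm_smul_right, herm_smul_left, hxx, hxN, hNx, hNN, map_mul, Complex.conj_I,
      Complex.conj_ofReal, hlamC]
    linear_combination hnormC - ((a : ℂ) ^ 2 * (rotation s r : ℂ) ^ 2) * Complex.I_mul_I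
  have hh : IsU11 !![x 0, y 0; x 1, y 1] := by
    rw [herm_fin_two] at hxx hxy hyy
    exact ⟨hxx, hyy, hxy⟩
  obtain ⟨h', hh', -, hinv⟩ := hh.exists_inverse
  -- The frame in which `(w 0, w₁ 0)` has coordinates `(x, y)`, so that the initial data agree.
  set u := (U 0).mul h' hh' with hu
  have hux : comb u x = (w 0).1 := by
    have : x = !![x 0, y 0; x 1, y 1] *ᵥ ![1, 0] := by
      funext i
      fin_cases i <;> simp [Matrix.mulVec, dotProduct]
    rw [hu, comb_mul, this, Matrix.mulVec_mulVec, hinv]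
    simp [comb, U]
  have huy : comb u y = w₁ 0 := by
    have : y = !![x 0, y 0; x 1, y 1] *ᵥ ![0, 1] := by
      funext i
      fin_cases i <;> simp [Matrix.mulVec, dotProduct]
    rw [hu, comb_mul, this, Matrix.mulVec_mulVec, hinv]
    simp [comb, U]
  have hexp : ∀ t : ℝ, HasDerivAt (fun τ : ℝ => Complex.exp ((lam : ℂ) * τ * Complex.I))
      (Complex.exp ((lam : ℂ) * t * Complex.I) * (Complex.I * lam)) t := fun t =>
    ((((hasDerivAt_ofReal t).const_mul (lam : ℂ)).mul_const Complex.I).cexp).congr_deriv (by ring)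
  have hat : ∀ t : ℝ, HasDerivAt (fun τ : ℝ => a * τ) a t := fun t => by
    simpa using (hasDerivAt_id t).const_mul a
  have hcc : ∀ t, HasDerivAt (fun τ => curveCoord s r (a * τ))
      ((a : ℂ) • (gen s *ᵥ curveCoord s r (a * t))) t := fun t => by
    rw [Complex.coe_smul]
    exact (hasDerivAt_curveCoord s r (a * t)).scomp t (hat t)
  have hgcc : ∀ t, HasDerivAt (fun τ => gen s *ᵥ curveCoord s r (a * τ))
      ((a : ℂ) • (genSq s : ℂ) • curveCoord s r (a * t)) t := fun t => by
    rw [Complex.coe_smul]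
    exact (hasDerivAt_gen_curveCoord s r (a * t)).scomp t (hat t)
  have hfin := eq_of_second_order (μ := Complex.I * (k 0 : ℂ)) (w := fun t => (w t).1) (w₁ := w₁)
    (W := fun t => Complex.exp ((lam : ℂ) * t * Complex.I) • comb u (curveCoord s r (a * t)))
    (W₁ := fun t => Complex.exp ((lam : ℂ) * t * Complex.I) •
      comb u ((Complex.I * (lam : ℂ)) • curveCoord s r (a * t) +
        (a : ℂ) • (gen s *ᵥ curveCoord s r (a * t))))
    hL.hasDerivAt (fun t => by rw [← hconst t, ← hw2]; exact hL.hasDerivAt' t)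
    (fun t => by
      refine ((hexp t).smul (hasDerivAt_comb u (hcc t))).congr_deriv ?_
      simp only [comb_add, comb_smul]
      module)
    (fun t => by
      have hd : HasDerivAt (fun τ => (Complex.I * (lam : ℂ)) • curveCoord s r (a * τ) +
          (a : ℂ) • (gen s *ᵥ curveCoord s r (a * τ))) _ t :=
        ((hcc t).const_smul (Complex.I * (lam : ℂ))).add ((hgcc t).const_smul (a : ℂ))
      refine ((hexp t).smul (hasDerivAt_comb u hd)).congr_deriv ?_
      have e : (a : ℂ) * (a * (genSq s : ℂ)) = 1 - (lam : ℂ) ^ 2 := by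
        rw [hlamC]
        linear_combination hnormC
      have e2 : (k 0 : ℂ) = 2 * lam := by
        rw [← hka]
        push_cast
        rfl
      simp only [comb_add, comb_smul, e2, smul_smul, smul_add]
      rw [e]
      match_scalars
      · ring
      · linear_combination (-Complex.exp ((lam : ℂ) * t * Complex.I) * (lam : ℂ) ^ 2) *
          Complex.I_mul_I)
    (by
      have : curveCoord s r 0 = x := by
        rw [curveCoord, oneParam_zero, Matrix.one_mulVec]
      simp [this, hux])
    (by
      have : curveCoord s r 0 = x := by
        rw [curveCoord, oneParam_zero, Matrix.one_mulVec]
      simp only [mul_zero, this, ← hy, huy]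
      simp)
  refine ⟨u, r, a, (plane_mul _ hh').trans (hUP 0), hr, ha, fun t => ?_⟩
  rw [hL.hopf_eq]
  exact (hopf_eq_of_smul (congrFun hfin t)).symm

/-! ### The orbits of the twistor actions -/

theorem exists_eq_exp_of_mul_conj {a : ℂ} (h : a * conj a = 1) :
    ∃ θ : ℝ, a = Complex.exp (θ * Complex.I) := by
  rw [Complex.mul_conj, Complex.normSq_eq_norm_sq] at h
  have h1 : ‖a‖ ^ 2 = 1 := by exact_mod_cast h
  have h2 : ‖a‖ = 1 := (pow_eq_one_iff_of_nonneg (norm_nonneg _) two_ne_zero).1 h1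
  have := Complex.norm_mul_exp_arg_mul_I a
  rw [h2, Complex.ofReal_one, one_mul] at this
  exact ⟨_, this.symm⟩

theorem exp_mul_conj_exp (θ : ℝ) :
    Complex.exp (θ * Complex.I) * conj (Complex.exp (θ * Complex.I)) = 1 := by
  rw [← Complex.exp_conj, ← Complex.exp_add]
  simp

theorem IsU11.smul {h : Matrix (Fin 2) (Fin 2) ℂ} (hh : IsU11 h) {a : ℂ} (ha : a * conj a = 1) :
    IsU11 (a • h) := by
  constructor <;> simp only [Matrix.smul_apply, smul_eq_mul, map_mul]
  · linear_combination a * conj a * hh.neg_neg - ha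
  · linear_combination a * conj a * hh.pos_pos + ha
  · linear_combination a * conj a * hh.neg_pos

theorem rel_iff_exists_smul {n : ℕ} {s : Kind} {u v : Stiefel n} :
    (twistorSetoid n s).r u v ↔ ∃ (θ t : ℝ) (hh : IsU11 (Complex.exp (θ * Complex.I) •
      oneParam s t)), v = u.mul _ hh := by
  have hn : ∀ (a : ℂ) (h : Matrix (Fin 2) (Fin 2) ℂ), mulNeg u (a • h) = a • mulNeg u h := by
    intro a h
    simp only [mulNeg, Matrix.smul_apply, smul_eq_mul]
    module
  have hp : ∀ (a : ℂ) (h : Matrix (Fin 2) (Fin 2) ℂ), mulPos u (a • h) = a • mulPos u h := by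
    intro a h
    simp only [mulPos, Matrix.smul_apply, smul_eq_mul]
    module
  constructor
  · rintro ⟨θ, t, h₁, h₂⟩
    exact ⟨θ, t, (isU11_oneParam s t).smul (exp_mul_conj_exp θ),
      Stiefel.ext' (h₁.trans (hn _ _).symm) (h₂.trans (hp _ _).symm)⟩
  · rintro ⟨θ, t, hh, rfl⟩
    exact ⟨θ, t, hn _ _, hp _ _⟩

theorem exists_real_of_conj_eq {x : ℂ} (h : conj x = x) : ∃ t : ℝ, x = t :=
  ⟨x.re, (Complex.conj_eq_iff_re.1 h).symm⟩

/-- The centralizer of the one-parameter group of kind `s` in `U(1,1)`. -/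
theorem IsU11.exists_of_commute {s : Kind} {h : Matrix (Fin 2) (Fin 2) ℂ} (hh : IsU11 h)
    (hc : h * gen s = gen s * h) :
    ∃ θ t : ℝ, h = Complex.exp (θ * Complex.I) • oneParam s t := by
  have h00 := congrFun (congrFun hc 0) 0
  have h01 := congrFun (congrFun hc 0) 1
  have h10 := congrFun (congrFun hc 1) 0
  have h11 := congrFun (congrFun hc 1) 1
  have hnn := hh.neg_neg
  have hpp := hh.pos_pos
  have hnp := hh.neg_pos
  cases s <;> simp [gen, Matrix.mul_apply, Fin.sum_univ_two] at h00 h01 h10 h11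
  -- A matrix commuting with $\mathrm{diag}(i,-i)$ is diagonal. The half sum and half difference of
  -- its two phases are $\theta$ and $t$.
  · have e01 : h 0 1 = 0 := by
      linear_combination (Complex.I / 2) * h01 + h 0 1 * Complex.I_mul_I
    have e10 : h 1 0 = 0 := by
      linear_combination (-Complex.I / 2) * h10 + h 1 0 * Complex.I_mul_I
    rw [e10] at hnn
    rw [e01] at hpp
    obtain ⟨α, hα⟩ := exists_eq_exp_of_mul_conj (a := h 0 0) (by linear_combination -hnn)
    obtain ⟨β, hβ⟩ := exists_eq_exp_of_mul_conj (a := h 1 1) (by linear_combination hpp)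
    refine ⟨(α + β) / 2, (α - β) / 2, ?_⟩
    ext i j
    fin_cases i <;> fin_cases j <;> simp [oneParam, ← Complex.exp_add, e01, e10, hα, hβ]
    · congr 1
      ring
    · congr 1
      ring
  -- Here `h` has equal diagonal and equal off-diagonal entries. The $U(1,1)$ relations make their
  -- quotient real, so one common phase can be removed, leaving $\cosh t$ and $\sinh t$.
  · have hp0 : h 0 0 ≠ 0 := by
      intro h0
      rw [h0, zero_mul, neg_zero, zero_add, Complex.mul_conj] at hnn
      have := congrArg Complex.re hnn
      simp only [Complex.ofReal_re, Complex.neg_re, Complex.one_re] at this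
      linarith [Complex.normSq_nonneg (h 1 0)]
    have hpn : ‖h 0 0‖ ≠ 0 := norm_ne_zero_iff.2 hp0
    have hpc : (‖h 0 0‖ : ℂ) ≠ 0 := by exact_mod_cast hpn
    have hnorm : h 0 0 * conj (h 0 0) = (‖h 0 0‖ : ℂ) ^ 2 := by
      rw [Complex.mul_conj, Complex.normSq_eq_norm_sq]
      push_cast
      rfl
    obtain ⟨θ, hθ⟩ := exists_eq_exp_of_mul_conj (a := h 0 0 / (‖h 0 0‖ : ℂ)) (by
      rw [map_div₀, Complex.conj_ofReal, div_mul_div_comm, hnorm]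
      field_simp)
    have e00 : h 0 0 = Complex.exp (θ * Complex.I) * (‖h 0 0‖ : ℂ) := by
      rw [← hθ]
      field_simp
    obtain ⟨x, hx⟩ := exists_real_of_conj_eq (x := h 1 0 * conj (h 0 0)) (by
      rw [map_mul, Complex.conj_conj]
      rw [h00, ← h01] at hnp
      linear_combination -hnp)
    set y : ℝ := x / ‖h 0 0‖ with hy
    have e10 : h 1 0 = Complex.exp (θ * Complex.I) * (y : ℂ) := by
      rw [← hθ, hy, Complex.ofReal_div, ← hx]
      field_simp
      linear_combination -h 1 0 * hnorm
    have hsq : ‖h 0 0‖ ^ 2 = 1 + y ^ 2 := by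
      have hy2 : h 1 0 * conj (h 1 0) = (y : ℂ) ^ 2 := by
        rw [e10, map_mul, Complex.conj_ofReal]
        linear_combination (y : ℂ) ^ 2 * exp_mul_conj_exp θ
      rw [hnorm, hy2] at hnn
      have : (‖h 0 0‖ : ℂ) ^ 2 = 1 + (y : ℂ) ^ 2 := by linear_combination -hnn
      exact_mod_cast this
    have hcosh : Real.cosh (Real.arsinh y) = ‖h 0 0‖ := by
      rw [Real.cosh_arsinh, ← hsq, Real.sqrt_sq (norm_nonneg _)]
    refine ⟨θ, Real.arsinh y, ?_⟩
    ext i j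
    fin_cases i <;> fin_cases j <;>
      simp only [oneParam, hcosh, Real.sinh_arsinh, Matrix.smul_apply, smul_eq_mul, Fin.zero_eta,
        Fin.mk_one, Matrix.of_apply, Matrix.cons_val_zero, Matrix.cons_val_one]
    · exact e00
    · rw [h00, e10]
    · exact e10
    · rw [← h01, ← e00]
  -- The commutant consists of $\alpha+qN$ with $q=h_{10}$. Membership in $U(1,1)$ gives
  -- $|\alpha|=1$ and $q\bar\alpha$ real, so $t=q\bar\alpha$, in accordance with $E_0(t)=1+tN$.
  · have e01 : h 0 1 = h 1 0 := by linear_combination h00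
    have e11 : h 1 1 = h 0 0 - 2 * Complex.I * h 1 0 := by
      linear_combination -h01 - 2 * Complex.I * e01
    set α : ℂ := h 0 0 - Complex.I * h 1 0 with hα
    have e00 : h 0 0 = α + Complex.I * h 1 0 := by rw [hα]; ring
    rw [e01, e11, e00] at hpp
    rw [e00] at hnn
    simp only [map_add, map_sub, map_mul, Complex.conj_I, map_ofNat] at hpp hnn
    have hone : α * conj α = 1 := by
      linear_combination (hpp - hnn) / 2 + h 1 0 * conj (h 1 0) * Complex.I_mul_I
    have hreal : α * conj (h 1 0) - h 1 0 * conj α = 0 := by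
      linear_combination (-Complex.I / 2) * (hpp + hnn) +
        (α * conj (h 1 0) - h 1 0 * conj α) * Complex.I_mul_I
    obtain ⟨θ, hθ⟩ := exists_eq_exp_of_mul_conj hone
    obtain ⟨t, ht⟩ := exists_real_of_conj_eq (x := h 1 0 * conj α) (by
      rw [map_mul, Complex.conj_conj]
      linear_combination hreal)
    have e10 : h 1 0 = Complex.exp (θ * Complex.I) * t := by
      rw [← hθ, ← ht]
      linear_combination -h 1 0 * hone
    refine ⟨θ, t, ?_⟩
    ext i j
    fin_cases i <;> fin_cases j <;>
      simp only [oneParam, Matrix.smul_apply, smul_eq_mul, Fin.zero_eta,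
        Fin.mk_one, Matrix.of_apply, Matrix.cons_val_zero, Matrix.cons_val_one]
    · rw [e00, e10, hθ]
      ring
    · rw [e01, e10]
    · exact e10
    · rw [e11, e00, e10, hθ]
      ring

/-- The equivalence becomes a commutation condition on the change of frame, which is the form used
for the bundle as well as for the families of curves. -/
theorem rel_iff_exists_commute {n : ℕ} {s : Kind} {u v : Stiefel n} :
    (twistorSetoid n s).r u v ↔ ∃ (h : Matrix (Fin 2) (Fin 2) ℂ) (hh : IsU11 h),
      v = u.mul h hh ∧ h * gen s = gen s * h := by
  rw [rel_iff_exists_smul]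
  constructor
  · rintro ⟨θ, t, hh, rfl⟩
    refine ⟨_, hh, rfl, ?_⟩
    rw [Matrix.smul_mul, Matrix.mul_smul, oneParam_mul_gen]
  · rintro ⟨h, hh, rfl, hc⟩
    obtain ⟨θ, t, rfl⟩ := hh.exists_of_commute hc
    exact ⟨θ, t, hh, rfl⟩

/-! ### Endomorphisms of the tangent spaces of the Grassmannian -/

/-- The endomorphism `X ↦ X ∘ f` of the tangent space at `P`. -/
noncomputable def precomp {n : ℕ} {P : Submodule ℂ (Fin (n + 1) → ℂ)} (f : Module.End ℂ P) :
    Module.End ℝ (Tangent P) where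
  toFun X := X ∘ₗ f
  map_add' _ _ := LinearMap.add_comp _ _ _
  map_smul' _ _ := LinearMap.smul_comp _ _ _

theorem rightMul_eq_precomp {n : ℕ} (u : Stiefel n) (A : Matrix (Fin 2) (Fin 2) ℂ) :
    rightMul u A = precomp (frameEnd u A) := rfl

/-- Tested on the rank one maps `φ.smulRight y` with a fixed nonzero `y` in `perp P`; linear
functionals `φ` separate points of `P`. -/
theorem precomp_injective {n : ℕ} {P : Submodule ℂ (Fin (n + 1) → ℂ)} [Nontrivial (perp P)] :
    Function.Injective (precomp : Module.End ℂ P → Module.End ℝ (Tangent P)) := by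
  intro f g hfg
  ext1 x
  obtain ⟨y, hy⟩ := exists_ne (0 : perp P)
  rw [← sub_eq_zero]
  refine (Module.forall_dual_apply_eq_zero_iff ℂ _).1 fun φ => ?_
  have h := LinearMap.congr_fun (LinearMap.congr_fun hfg (φ.smulRight y)) x
  have h' : φ (f x) • y.1 = φ (g x) • y.1 := congrArg Subtype.val h
  rw [map_sub, smul_left_injective ℂ (fun h0 => hy (Subtype.ext h0)) h', sub_self]

/-- Two linear equations in `n + 1 > 2` unknowns. This is where `2 ≤ n` enters: for `n = 1` the
tangent spaces are zero and endomorphisms carry no information. -/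
theorem nontrivial_perp_plane {n : ℕ} (hn : 2 ≤ n) (u : Stiefel n) :
    Nontrivial (perp (plane u)) := by
  let F : (Fin (n + 1) → ℂ) →ₗ[ℂ] Fin 2 → ℂ :=
    { toFun := fun x => ![herm x u.neg, herm x u.pos]
      map_add' := fun x y => by
        funext i
        fin_cases i <;> simp [herm_add_left]
      map_smul' := fun a x => by
        funext i
        fin_cases i <;> simp [herm_smul_left] }
  have hker : LinearMap.ker F ≠ ⊥ := LinearMap.ker_ne_bot_of_finrank_lt (by simp; omega)
  obtain ⟨x, hx, hx0⟩ := Submodule.exists_mem_ne_zero_of_ne_bot hker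
  have h0 : herm x u.neg = 0 := congrFun (LinearMap.mem_ker.1 hx) 0
  have h1 : herm x u.pos = 0 := congrFun (LinearMap.mem_ker.1 hx) 1
  refine ⟨⟨⟨x, fun y hy => ?_⟩, 0, fun h => hx0 (congrArg Subtype.val h)⟩⟩
  obtain ⟨ξ, rfl⟩ := (mem_plane_iff u y).1 hy
  rw [comb, herm_add_right, herm_smul_right, herm_smul_right, h0, h1]
  simp

theorem sigma_precomp_eq_iff {n : ℕ} {P Q : Submodule ℂ (Fin (n + 1) → ℂ)} [Nontrivial (perp P)]
    (f : Module.End ℂ P) (g : Module.End ℂ Q) :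
    (⟨P, precomp f⟩ : EndBundle n) = ⟨Q, precomp g⟩ ↔
      P = Q ∧ ∀ x (hP : x ∈ P) (hQ : x ∈ Q), (f ⟨x, hP⟩ : Fin (n + 1) → ℂ) = g ⟨x, hQ⟩ := by
  constructor
  · intro h
    obtain rfl : P = Q := congrArg Sigma.fst h
    refine ⟨rfl, fun x hP _ => ?_⟩
    rw [precomp_injective (eq_of_heq (Sigma.mk.inj h).2)]
  · rintro ⟨rfl, h⟩
    have : f = g := by
      ext1 x
      exact Subtype.ext (h x.1 x.2 x.2)
    rw [this]

theorem frameEnd_comb {n : ℕ} (u : Stiefel n) (A : Matrix (Fin 2) (Fin 2) ℂ) (ξ : Fin 2 → ℂ)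
    (h : comb u ξ ∈ plane u) : (frameEnd u A ⟨comb u ξ, h⟩).1 = comb u (A *ᵥ ξ) := by
  simp only [frameEnd, LinearMap.coe_mk, AddHom.coe_mk, comb, herm_add_left, herm_smul_left,
    u.herm_neg, u.herm_pos, u.herm_neg_pos, u.herm_pos_neg, Matrix.mulVec, dotProduct,
    Fin.sum_univ_two]
  module

/-- The change of basis rule: `A` in the frame `u h` and $hAh^{-1}$ in the frame `u` describe the
same endomorphism of the plane. -/
theorem sigma_rightMul_mul_iff {n : ℕ} (hn : 2 ≤ n) (u : Stiefel n)
    {h : Matrix (Fin 2) (Fin 2) ℂ} (hh : IsU11 h) (A B : Matrix (Fin 2) (Fin 2) ℂ) :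
    (⟨plane (u.mul h hh), rightMul (u.mul h hh) A⟩ : EndBundle n) = ⟨plane u, rightMul u B⟩ ↔
      h * A = B * h := by
  have := nontrivial_perp_plane hn (u.mul h hh)
  rw [rightMul_eq_precomp, rightMul_eq_precomp, sigma_precomp_eq_iff]
  have key : ∀ ξ (hP : comb (u.mul h hh) ξ ∈ plane (u.mul h hh))
      (hQ : comb (u.mul h hh) ξ ∈ plane u),
      (frameEnd (u.mul h hh) A ⟨_, hP⟩).1 = (frameEnd u B ⟨_, hQ⟩).1 ↔
      (h * A) *ᵥ ξ = (B * h) *ᵥ ξ := fun ξ hP hQ => by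
    -- The same vector has coordinates `ξ` in the frame `u h` and `h *ᵥ ξ` in the frame `u`.
    have e : frameEnd u B ⟨_, hQ⟩ = frameEnd u B ⟨_, comb_mem u (h *ᵥ ξ)⟩ :=
      congrArg (frameEnd u B) (Subtype.ext (comb_mul u hh ξ))
    rw [frameEnd_comb, e, frameEnd_comb, comb_mul, (comb_injective u).eq_iff,
      Matrix.mulVec_mulVec, Matrix.mulVec_mulVec]
  constructor
  · rintro ⟨hP, hx⟩
    have hm : ∀ ξ, (h * A) *ᵥ ξ = (B * h) *ᵥ ξ := fun ξ =>
      (key ξ (comb_mem _ _) (hP ▸ comb_mem _ _)).1 (hx _ _ _)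
    exact Matrix.ext_iff_mulVec.2 hm
  · intro hAB
    refine ⟨plane_mul u hh, fun x hP hQ => ?_⟩
    obtain ⟨ξ, rfl⟩ := (mem_plane_iff _ _).1 hP
    exact (key ξ hP hQ).2 (by rw [hAB])

theorem frameStructure_eq {n : ℕ} (u : Stiefel n) (s : Kind) :
    frameStructure u s = rightMul u (gen s) := by
  cases s
  · rfl
  · rfl
  · change rightMul u _ + rightMul u _ = _
    refine LinearMap.ext fun X => LinearMap.ext fun x => ?_
    change X _ + X _ = X _
    rw [← map_add]
    congr 1
    obtain ⟨x, hx⟩ := x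
    obtain ⟨ξ, rfl⟩ := (mem_plane_iff _ _).1 hx
    refine Subtype.ext ?_
    rw [Submodule.coe_add, frameEnd_comb, frameEnd_comb, frameEnd_comb, ← comb_add,
      ← Matrix.add_mulVec]
    congr 2
    simp [gen]

/-- The matrix of `a I₁ + b I₂ + c I₃`. -/
noncomputable def pqMatrix (a b c : ℝ) : Matrix (Fin 2) (Fin 2) ℂ :=
  !![a * Complex.I, b - c * Complex.I; b + c * Complex.I, -(a * Complex.I)]

theorem real_smul_apply {n : ℕ} {P : Submodule ℂ (Fin (n + 1) → ℂ)} (X : Tangent P) (a : ℝ)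
    (x : P) : a • X x = X ((a : ℂ) • x) :=
  (Subtype.ext (Complex.coe_smul a (X x).1).symm).trans (X.map_smul (a : ℂ) x).symm

theorem pqEnd_eq {n : ℕ} (u : Stiefel n) (a b c : ℝ) :
    pqEnd u a b c = rightMul u (pqMatrix a b c) := by
  refine LinearMap.ext fun X => LinearMap.ext fun x => ?_
  change a • X _ + b • X _ + c • X _ = X _
  rw [real_smul_apply, real_smul_apply, real_smul_apply, ← map_add, ← map_add]
  congr 1
  obtain ⟨x, hx⟩ := x
  obtain ⟨ξ, rfl⟩ := (mem_plane_iff _ _).1 hx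
  refine Subtype.ext ?_
  simp only [Submodule.coe_add, Submodule.coe_smul, frameEnd_comb, ← comb_add, ← comb_smul,
    ← Matrix.smul_mulVec, ← Matrix.add_mulVec]
  congr 2
  ext i j
  fin_cases i <;> fin_cases j <;> simp [pqMatrix]
  ring

theorem rightMul_mul_rightMul {n : ℕ} (u : Stiefel n) (A B : Matrix (Fin 2) (Fin 2) ℂ) :
    rightMul u A * rightMul u B = rightMul u (B * A) := by
  refine LinearMap.ext fun X => LinearMap.ext fun x => ?_
  change X _ = X _
  congr 1
  obtain ⟨x, hx⟩ := x
  obtain ⟨ξ, rfl⟩ := (mem_plane_iff _ _).1 hx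
  have e : frameEnd u A ⟨comb u ξ, hx⟩ = ⟨comb u (A *ᵥ ξ), comb_mem u _⟩ :=
    Subtype.ext (frameEnd_comb u A ξ hx)
  rw [e]
  refine Subtype.ext ?_
  rw [frameEnd_comb, frameEnd_comb, Matrix.mulVec_mulVec]

theorem rightMul_smul_one {n : ℕ} (u : Stiefel n) (k : ℝ) :
    rightMul u ((k : ℂ) • 1) = k • 1 := by
  refine LinearMap.ext fun X => LinearMap.ext fun x => ?_
  change X _ = k • X _
  rw [real_smul_apply]
  congr 1
  obtain ⟨x, hx⟩ := x
  obtain ⟨ξ, rfl⟩ := (mem_plane_iff _ _).1 hx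
  refine Subtype.ext ?_
  rw [frameEnd_comb, Matrix.smul_mulVec, Matrix.one_mulVec, comb_smul, Submodule.coe_smul]

/-- The conditions $I^2=-1,1,0$ thereby become the quadrics $-a^2+b^2+c^2=-1,1,0$. -/
theorem pqEnd_mul_self {n : ℕ} (u : Stiefel n) (a b c : ℝ) :
    pqEnd u a b c * pqEnd u a b c = (-a ^ 2 + b ^ 2 + c ^ 2) • 1 := by
  rw [pqEnd_eq, rightMul_mul_rightMul, ← rightMul_smul_one]
  congr 1
  ext i j
  fin_cases i <;> fin_cases j <;> simp [pqMatrix, Matrix.mul_apply, Fin.sum_univ_two]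
  · linear_combination (a ^ 2 - c ^ 2 : ℂ) * Complex.I_mul_I
  · ring
  · ring
  · linear_combination (a ^ 2 - c ^ 2 : ℂ) * Complex.I_mul_I

theorem smul_one_inj {n : ℕ} (hn : 2 ≤ n) (u : Stiefel n) {k l : ℝ}
    (h : (k • 1 : Module.End ℝ (Tangent (plane u))) = l • 1) : k = l := by
  have := nontrivial_perp_plane hn u
  rw [← rightMul_smul_one, ← rightMul_smul_one, rightMul_eq_precomp, rightMul_eq_precomp] at h
  have h' := congrArg Subtype.val (LinearMap.congr_fun (precomp_injective h)
    ⟨comb u ![1, 0], comb_mem u _⟩)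
  rw [frameEnd_comb, frameEnd_comb] at h'
  have h'' := congrFun (comb_injective u h') 0
  simpa [Matrix.smul_mulVec] using h''

/-! ### The twistor spaces as bundles over the Grassmannian -/

theorem exists_polar (b c : ℝ) : ∃ ε : ℂ, ε * conj ε = 1 ∧
    (b : ℂ) + c * Complex.I = (Real.sqrt (b ^ 2 + c ^ 2) : ℂ) * ε := by
  refine ⟨Complex.exp (Complex.arg (b + c * Complex.I) * Complex.I), exp_mul_conj_exp _, ?_⟩
  have h := Complex.norm_mul_exp_arg_mul_I ((b : ℂ) + c * Complex.I)
  rw [Complex.norm_add_mul_I] at h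
  exact h.symm

/-- The condition on `a, b, c` in the definition of the bundle of kind `s`. -/
def IsTwistorCoeff : Kind → ℝ → ℝ → ℝ → Prop
  | .plus, a, b, c => 0 < a ∧ -a ^ 2 + b ^ 2 + c ^ 2 = -1
  | .minus, a, b, c => -a ^ 2 + b ^ 2 + c ^ 2 = 1
  | .zero, a, b, c => 0 < a ∧ -a ^ 2 + b ^ 2 + c ^ 2 = 0

theorem mem_twistorBundle_iff {n : ℕ} (hn : 2 ≤ n) (s : Kind) (x : EndBundle n) :
    x ∈ twistorBundle n s ↔ ∃ (u : Stiefel n) (a b c : ℝ), IsTwistorCoeff s a b c ∧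
      x = ⟨plane u, rightMul u (pqMatrix a b c)⟩ := by
  have hsq : ∀ (u : Stiefel n) (a b c k : ℝ), pqEnd u a b c * pqEnd u a b c = k • 1 ↔
      -a ^ 2 + b ^ 2 + c ^ 2 = k := fun u a b c k => by
    rw [pqEnd_mul_self]
    exact ⟨smul_one_inj hn u, fun h => by rw [h]⟩
  cases s
  · simp only [twistorBundle, Set.mem_ofPred_eq, IsTwistorCoeff, pqEnd_eq, and_assoc]
    simp only [← pqEnd_eq, hsq]
  · have h1 := fun (u : Stiefel n) (a b c : ℝ) => hsq u a b c 1
    simp only [one_smul] at h1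
    simp only [twistorBundle, Set.mem_ofPred_eq, IsTwistorCoeff, ← pqEnd_eq, h1]
  · have h0 := fun (u : Stiefel n) (a b c : ℝ) => hsq u a b c 0
    simp only [zero_smul] at h0
    simp only [twistorBundle, Set.mem_ofPred_eq, IsTwistorCoeff, ← pqEnd_eq, h0, and_assoc]

/-- With $m=\sqrt{b^2+c^2}$, a hyperbolic rotation of the $(a,m)$ plane reaches a standard point:
$(a,m)$ is $(\cosh 2\rho,\sinh 2\rho)$, $(\sinh 2\rho,\cosh 2\rho)$ or $(e^{2\rho},e^{2\rho})$. The
half angle appears because $U(1,1)$ acts by conjugation; the two equations are the entries of the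
conjugation identity. -/
theorem exists_boost {a b c : ℝ} {s : Kind} (h : IsTwistorCoeff s a b c) :
    ∃ ρ : ℝ,
      Complex.I * (a * Real.cosh ρ - Real.sqrt (b ^ 2 + c ^ 2) * Real.sinh ρ : ℝ) =
        gen s 0 0 * Real.cosh ρ + Complex.I * gen s 0 1 * Real.sinh ρ ∧
      ((Real.sqrt (b ^ 2 + c ^ 2) * Real.cosh ρ - a * Real.sinh ρ : ℝ) : ℂ) =
        gen s 0 1 * Real.cosh ρ - Complex.I * gen s 0 0 * Real.sinh ρ := by
  set m := Real.sqrt (b ^ 2 + c ^ 2) with hm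
  have hm2 : m ^ 2 = b ^ 2 + c ^ 2 := Real.sq_sqrt (by positivity)
  have hm0 : 0 ≤ m := Real.sqrt_nonneg _
  have hhalf : ∀ x : ℝ, x - x / 2 = x / 2 := fun x => by ring
  cases s
  · obtain ⟨ha, h⟩ := h
    have hc : Real.cosh (Real.arsinh m) = a := by
      rw [Real.cosh_arsinh, hm2, show 1 + (b ^ 2 + c ^ 2) = a ^ 2 by linarith, Real.sqrt_sq ha.le]
    have h1 := Real.cosh_sub (Real.arsinh m) (Real.arsinh m / 2)
    have h2 := Real.sinh_sub (Real.arsinh m) (Real.arsinh m / 2)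
    rw [hhalf, Real.sinh_arsinh, hc] at h1 h2
    refine ⟨Real.arsinh m / 2, ?_, ?_⟩
    · rw [← h1]
      simp [gen]
    · rw [← h2]
      simp only [gen, Matrix.of_apply, Matrix.cons_val_zero, Matrix.cons_val_one]
      linear_combination (Real.sinh (Real.arsinh m / 2) : ℂ) * Complex.I_mul_I
  · replace h : -a ^ 2 + b ^ 2 + c ^ 2 = 1 := h
    have hc : Real.cosh (Real.arsinh a) = m := by
      rw [Real.cosh_arsinh, show 1 + a ^ 2 = m ^ 2 by rw [hm2]; linarith, Real.sqrt_sq hm0]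
    have h1 := Real.cosh_sub (Real.arsinh a) (Real.arsinh a / 2)
    have h2 := Real.sinh_sub (Real.arsinh a) (Real.arsinh a / 2)
    rw [hhalf, Real.sinh_arsinh, hc] at h1 h2
    refine ⟨Real.arsinh a / 2, ?_, ?_⟩
    · rw [← h2]
      simp [gen]
    · rw [← h1]
      simp [gen]
  · obtain ⟨ha, h⟩ := h
    have hma : m = a := by
      rw [hm, show b ^ 2 + c ^ 2 = a ^ 2 by linarith, Real.sqrt_sq ha.le]
    have he : a * (Real.cosh (Real.log a / 2) - Real.sinh (Real.log a / 2)) =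
        Real.cosh (Real.log a / 2) + Real.sinh (Real.log a / 2) := by
      rw [Real.cosh_sub_sinh, Real.cosh_add_sinh]
      conv_lhs => rw [← Real.exp_log ha]
      rw [Real.exp_log ha]
      nth_rewrite 1 [← Real.exp_log ha]
      rw [← Real.exp_add]
      congr 1
      ring
    refine ⟨Real.log a / 2, ?_, ?_⟩
    · rw [hma, ← mul_sub, he]
      simp only [gen, Matrix.of_apply, Matrix.cons_val_zero, Matrix.cons_val_one]
      push_cast
      ring
    · rw [hma, ← mul_sub, he]
      simp only [gen, Matrix.of_apply, Matrix.cons_val_zero, Matrix.cons_val_one]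
      push_cast
      linear_combination Complex.sinh (Real.log a / 2 : ℂ) * Complex.I_mul_I

/-- The conjugating matrix is $\mathrm{diag}(1,\varepsilon)$ times a boost: the phase $\varepsilon$
of $b+ic$ rotates $(b,c)$ to $(\sqrt{b^2+c^2},0)$, and the boost settles the rest. -/
theorem exists_conjugate {a b c : ℝ} {s : Kind} (h : IsTwistorCoeff s a b c) :
    ∃ g, IsU11 g ∧ g * gen s = pqMatrix a b c * g := by
  obtain ⟨ρ, h1, h2⟩ := exists_boost h
  obtain ⟨ε, hε, hbc⟩ := exists_polar b c
  have hbc' : (b : ℂ) - c * Complex.I = (Real.sqrt (b ^ 2 + c ^ 2) : ℂ) * conj ε := by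
    have := congrArg conj hbc
    simp only [map_add, map_mul, Complex.conj_ofReal, Complex.conj_I] at this
    rw [← this]
    ring
  have hc : (Real.cosh ρ : ℂ) ^ 2 = (Real.sinh ρ : ℂ) ^ 2 + 1 := by
    exact_mod_cast Real.cosh_sq ρ
  have hg : gen s 1 0 = gen s 0 1 ∧ gen s 1 1 = -gen s 0 0 := by cases s <;> simp [gen]
  refine ⟨!![(Real.cosh ρ : ℂ), Complex.I * Real.sinh ρ; -(Complex.I * ε * Real.sinh ρ),
    ε * Real.cosh ρ], ⟨?_, ?_, ?_⟩, ?_⟩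
  · simp only [Matrix.of_apply, Matrix.cons_val_zero, Matrix.cons_val_one, map_neg, map_mul,
      Complex.conj_ofReal, Complex.conj_I]
    linear_combination -hc + (Real.sinh ρ : ℂ) ^ 2 * hε -
      (ε * conj ε * (Real.sinh ρ : ℂ) ^ 2) * Complex.I_mul_I
  · simp only [Matrix.of_apply, Matrix.cons_val_zero, Matrix.cons_val_one, map_mul,
      Complex.conj_ofReal, Complex.conj_I]
    linear_combination hc + (Real.cosh ρ : ℂ) ^ 2 * hε +
      ((Real.sinh ρ : ℂ) ^ 2) * Complex.I_mul_I
  · simp only [Matrix.of_apply, Matrix.cons_val_zero, Matrix.cons_val_one, map_mul,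
      Complex.conj_ofReal, Complex.conj_I]
    linear_combination -(Complex.I * Real.sinh ρ * Real.cosh ρ) * hε
  · rw [Complex.ofReal_sub, Complex.ofReal_mul, Complex.ofReal_mul] at h1 h2
    ext i j
    fin_cases i <;> fin_cases j <;>
      simp only [pqMatrix, Matrix.mul_apply, Fin.sum_univ_two, Matrix.of_apply,
        Matrix.cons_val_zero, Matrix.cons_val_one, Fin.zero_eta, Fin.mk_one, hg.1, hg.2, hbc, hbc']
    · linear_combination -h1 + Complex.I * Real.sqrt (b ^ 2 + c ^ 2) * Real.sinh ρ * hε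
    · linear_combination -h2 - Real.sqrt (b ^ 2 + c ^ 2) * Real.cosh ρ * hε -
        (a * Real.sinh ρ : ℂ) * Complex.I_mul_I
    · linear_combination -ε * h2 - (ε * a * Real.sinh ρ : ℂ) * Complex.I_mul_I
    · linear_combination ε * h1

theorem isTwistorCoeff_gen (s : Kind) : ∃ a b c, IsTwistorCoeff s a b c ∧ pqMatrix a b c = gen s := by
  cases s
  · exact ⟨1, 0, 0, by norm_num [IsTwistorCoeff], by simp [pqMatrix, gen]⟩
  · exact ⟨0, 1, 0, by norm_num [IsTwistorCoeff], by simp [pqMatrix, gen]⟩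
  · exact ⟨1, 1, 0, by norm_num [IsTwistorCoeff], by simp [pqMatrix, gen]⟩

theorem frameStructure_eq_iff {n : ℕ} (hn : 2 ≤ n) (s : Kind) (u v : Stiefel n) :
    (⟨plane u, frameStructure u s⟩ : EndBundle n) = ⟨plane v, frameStructure v s⟩ ↔
      (twistorSetoid n s).r u v := by
  rw [rel_iff_exists_commute, frameStructure_eq, frameStructure_eq]
  constructor
  · intro h
    have hP : plane u = plane v := congrArg Sigma.fst h
    obtain ⟨g, hg, rfl⟩ := exists_eq_mul (u := u) (v := v)
      (hP ▸ Submodule.subset_span (by simp)) (hP ▸ Submodule.subset_span (by simp))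
    exact ⟨g, hg, rfl, (sigma_rightMul_mul_iff hn u hg _ _).1 h.symm⟩
  · rintro ⟨g, hg, rfl, hc⟩
    exact ((sigma_rightMul_mul_iff hn u hg _ _).2 hc).symm

theorem exists_equiv_twistorBundle {n : ℕ} (hn : 2 ≤ n) (s : Kind) :
    ∃ e : TwistorSpace n s ≃ twistorBundle n s,
      ∀ u : Stiefel n, (e (toTwistor s u)).1 = ⟨plane u, frameStructure u s⟩ := by
  let F : TwistorSpace n s → twistorBundle n s := Quotient.lift (s := twistorSetoid n s)
    (fun u => ⟨⟨plane u, frameStructure u s⟩, by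
      obtain ⟨a, b, c, h, hg⟩ := isTwistorCoeff_gen s
      exact (mem_twistorBundle_iff hn s _).2 ⟨u, a, b, c, h, by rw [hg, frameStructure_eq]⟩⟩)
    (fun u v h => Subtype.ext ((frameStructure_eq_iff hn s u v).2 h))
  refine ⟨Equiv.ofBijective F ⟨?_, ?_⟩, fun u => rfl⟩
  · rintro ⟨u⟩ ⟨v⟩ h
    exact Quotient.sound ((frameStructure_eq_iff hn s u v).1 (congrArg Subtype.val h))
  · rintro ⟨x, hx⟩
    obtain ⟨u, a, b, c, h, rfl⟩ := (mem_twistorBundle_iff hn s x).1 hx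
    obtain ⟨g, hg, hc⟩ := exists_conjugate h
    refine ⟨toTwistor s (u.mul g hg), Subtype.ext ?_⟩
    change (⟨plane (u.mul g hg), frameStructure (u.mul g hg) s⟩ : EndBundle n) = _
    rw [frameStructure_eq]
    exact (sigma_rightMul_mul_iff hn u hg _ _).2 hc

/-! ### The twistor spaces as sets of families of curves -/

theorem curveFamily_subset_of_rel {n : ℕ} {s : Kind} {u v : Stiefel n}
    (h : (twistorSetoid n s).r u v) (r : ℝ) : curveFamily s v r ⊆ curveFamily s u r := by
  obtain ⟨θ, t₀, hh, rfl⟩ := rel_iff_exists_smul.1 h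
  rintro _ ⟨t, rfl⟩
  -- The phase is lost in the projection, and the one-parameter group only shifts the parameter of
  -- each curve.
  refine ⟨t₀ + t, hopf_eq_of_smul (a := Complex.exp (θ * Complex.I)) ?_⟩
  rw [gamma_coe, gamma_coe, comb_mul, Matrix.smul_mulVec, comb_smul, curveCoord, curveCoord,
    Matrix.mulVec_mulVec, ← oneParam_add]

/-- For $s=+$ all diagonal matrices commute with the generator. For $s=-,0$ the matrix
$\mathrm{diag}(1,\delta)$ preserves the modulus of the first coordinate, and along the orbit of
`startVec s 1` that modulus takes its initial value only at $t=0$; hence the matrix is the identity.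
-/
theorem diagonal_commute_of_orbit {s : Kind} {g : Matrix (Fin 2) (Fin 2) ℂ} {e : ℂ} {t : ℝ}
    (h10 : g 1 0 = 0) (h01 : g 0 1 = 0) (h00 : g 0 0 = 1) (he : e * conj e = 1)
    (h : g *ᵥ startVec s 1 = e • (oneParam s t *ᵥ startVec s 1)) : g * gen s = gen s * g := by
  have hC : (Real.cosh 1 : ℂ) ≠ 0 := by exact_mod_cast (Real.cosh_pos 1).ne'
  have hS : (Real.sinh 1 : ℂ) ≠ 0 := by exact_mod_cast (Real.sinh_pos_iff.2 one_pos).ne'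
  have hone : s ≠ .plus → t = 0 → g = 1 := by
    rintro hs rfl
    rw [oneParam_zero, Matrix.one_mulVec] at h
    have e0 := congrFun h 0
    have e1 := congrFun h 1
    have he1 : e = 1 := by
      cases s <;> simp [startVec, Matrix.mulVec, dotProduct, Fin.sum_univ_two, h01, h00,
        -Complex.ofReal_cosh, -Complex.ofReal_sinh] at e0
      · exact absurd rfl hs
      · exact mul_right_cancel₀ hC (by rw [← e0, one_mul])
      · exact mul_right_cancel₀ hC (by rw [← e0, one_mul])
    have h11 : g 1 1 = 1 := by
      rw [he1] at e1
      cases s <;> simp [startVec, Matrix.mulVec, dotProduct, Fin.sum_univ_two, h10,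
        -Complex.ofReal_cosh, -Complex.ofReal_sinh] at e1
      · exact absurd rfl hs
      · exact mul_right_cancel₀ (mul_ne_zero Complex.I_ne_zero hS) (by rw [e1, one_mul])
      · exact mul_right_cancel₀ (mul_ne_zero Complex.I_ne_zero hS) (by rw [e1, one_mul])
    ext i j
    fin_cases i <;> fin_cases j <;> simp [h00, h01, h10, h11]
  have e0 := congrFun h 0
  have hpos := Real.cosh_pos 1
  have hspos := Real.sinh_pos_iff.2 one_pos
  cases s <;> simp [startVec, oneParam, Matrix.mulVec, dotProduct, Fin.sum_univ_two, h01, h00,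
    -Complex.ofReal_cosh, -Complex.ofReal_sinh] at e0
  · ext i j
    fin_cases i <;> fin_cases j <;> simp [gen, Matrix.mul_apply, Fin.sum_univ_two, h01, h10, h00,
      mul_comm]
  · have e0' := congrArg conj e0
    simp only [map_mul, map_add, Complex.conj_ofReal, Complex.conj_I] at e0'
    -- Squared moduli of the first coordinates, obtained by multiplying the equation with its
    -- conjugate.
    have key : (Real.cosh 1 : ℂ) * Real.cosh 1 = (Real.cosh t : ℂ) ^ 2 * (Real.cosh 1 : ℂ) ^ 2 +
        (Real.sinh t : ℂ) ^ 2 * (Real.sinh 1 : ℂ) ^ 2 := by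
      have hm := congrArg₂ (· * ·) e0 e0'
      linear_combination hm + ((Real.cosh t : ℂ) ^ 2 * (Real.cosh 1 : ℂ) ^ 2 -
        Complex.I ^ 2 * (Real.sinh t : ℂ) ^ 2 * (Real.sinh 1 : ℂ) ^ 2) * he -
        (Real.sinh t : ℂ) ^ 2 * (Real.sinh 1 : ℂ) ^ 2 * Complex.I_mul_I
    have key' : Real.cosh 1 * Real.cosh 1 = Real.cosh t ^ 2 * Real.cosh 1 ^ 2 +
        Real.sinh t ^ 2 * Real.sinh 1 ^ 2 := by exact_mod_cast key
    rw [Real.cosh_sq t] at key'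
    have hz : Real.sinh t ^ 2 * (Real.cosh 1 ^ 2 + Real.sinh 1 ^ 2) = 0 := by linarith
    have ht : Real.sinh t = 0 := by
      rcases mul_eq_zero.1 hz with h | h
      · exact pow_eq_zero_iff two_ne_zero |>.1 h
      · exact absurd h (by positivity)
    rw [hone (by simp) (Real.sinh_eq_zero.1 ht), one_mul, mul_one]
  · have e0' := congrArg conj e0
    simp only [map_mul, map_add, Complex.conj_ofReal, Complex.conj_I] at e0'
    have key : (Real.cosh 1 : ℂ) * Real.cosh 1 = (Real.cosh 1 : ℂ) ^ 2 +
        (t : ℂ) ^ 2 * (Real.cosh 1 + Real.sinh 1 : ℂ) ^ 2 := by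
      have hm := congrArg₂ (· * ·) e0 e0'
      linear_combination hm + ((Real.cosh 1 : ℂ) ^ 2 - Complex.I ^ 2 *
        (t : ℂ) ^ 2 * (Real.cosh 1 + Real.sinh 1 : ℂ) ^ 2) * he -
        (t : ℂ) ^ 2 * (Real.cosh 1 + Real.sinh 1 : ℂ) ^ 2 * Complex.I_mul_I
    have key' : Real.cosh 1 * Real.cosh 1 = Real.cosh 1 ^ 2 +
        t ^ 2 * (Real.cosh 1 + Real.sinh 1) ^ 2 := by exact_mod_cast key
    have hz : t ^ 2 * (Real.cosh 1 + Real.sinh 1) ^ 2 = 0 := by linarith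
    have ht : t = 0 := by
      rcases mul_eq_zero.1 hz with h | h
      · exact pow_eq_zero_iff two_ne_zero |>.1 h
      · exact absurd h (by positivity)
    rw [hone (by simp) ht, one_mul, mul_one]

theorem startVec_zero (s : Kind) : startVec s 0 = ![1, 0] := by
  cases s <;> simp [startVec]

/-- Two members determine the orbit: the curve `r = 0` locates `v.neg` up to the action, and the
curve `r = 1` then controls `v.pos`. -/
theorem rel_of_curveFamily_eq {n : ℕ} {s : Kind} {u v : Stiefel n}
    (h : curveFamily s u = curveFamily s v) : (twistorSetoid n s).r u v := by
  have hr : ∀ r, ∃ θ t : ℝ, comb v (startVec s r) =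
      Complex.exp (θ * Complex.I) • comb u (curveCoord s r t) := fun r => by
    have hm : curve s v r 0 ∈ curveFamily s u r := by
      rw [h]
      exact ⟨0, rfl⟩
    obtain ⟨t, ht⟩ := hm
    obtain ⟨θ, hθ⟩ := exists_smul_of_hopf_eq ht
    refine ⟨θ, t, ?_⟩
    rw [gamma_coe, gamma_coe, curveCoord, oneParam_zero, Matrix.one_mulVec] at hθ
    exact hθ
  obtain ⟨θ₀, t₀, h₀⟩ := hr 0
  obtain ⟨θ₁, t₁, h₁⟩ := hr 1
  have hneg : v.neg ∈ plane u := by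
    have e : comb v (startVec s 0) = v.neg := by simp [startVec_zero, comb]
    rw [← e, h₀]
    exact (plane u).smul_mem _ (comb_mem u _)
  have hpos : v.pos ∈ plane u := by
    have hS : startVec s 1 1 ≠ 0 := by
      cases s <;> simp [startVec, -Complex.ofReal_sinh]
    have e : startVec s 1 1 • v.pos = comb v (startVec s 1) - startVec s 1 0 • v.neg := by
      rw [comb, add_sub_cancel_left]
    rw [← (plane u).smul_mem_iff hS, e, h₁]
    exact (plane u).sub_mem ((plane u).smul_mem _ (comb_mem u _)) ((plane u).smul_mem _ hneg)
  obtain ⟨k, hk, rfl⟩ := exists_eq_mul hneg hpos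
  rw [comb_mul, ← comb_smul, (comb_injective u).eq_iff, curveCoord] at h₀ h₁
  -- The inverse of the group element that carries `u.neg` to `v.neg`; after this correction the
  -- change of frame fixes the first basis vector.
  set K := Complex.exp (((-θ₀ : ℝ) : ℂ) * Complex.I) • oneParam s (-t₀) with hK
  have hexp : Complex.exp (((-θ₀ : ℝ) : ℂ) * Complex.I) * Complex.exp (θ₀ * Complex.I) = 1 := by
    rw [← Complex.exp_add]
    simp
  have hKinv : (Complex.exp (θ₀ * Complex.I) • oneParam s t₀) * K = 1 := by
    rw [hK, smul_mul_smul_comm, ← oneParam_add, add_neg_cancel, oneParam_zero, mul_comm, hexp,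
      one_smul]
  have hKv : ∀ (θ t : ℝ) (ξ : Fin 2 → ℂ),
      K *ᵥ (Complex.exp (θ * Complex.I) • (oneParam s t *ᵥ ξ)) =
      Complex.exp (((θ - θ₀ : ℝ) : ℂ) * Complex.I) • (oneParam s (t - t₀) *ᵥ ξ) := fun θ t ξ => by
    rw [hK, Matrix.mulVec_smul, Matrix.smul_mulVec, Matrix.mulVec_mulVec, ← oneParam_add, smul_smul,
      ← Complex.exp_add, neg_add_eq_sub]
    congr 2
    push_cast
    ring
  have hKU : IsU11 K := (isU11_oneParam s _).smul (exp_mul_conj_exp _)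
  have g₀ : (K * k) *ᵥ ![1, 0] = ![1, 0] := by
    rw [← startVec_zero s, ← Matrix.mulVec_mulVec, h₀, hKv, sub_self, sub_self, oneParam_zero]
    simp
  have g₁ := congrArg (fun x => K *ᵥ x) h₁
  simp only [hKv, Matrix.mulVec_mulVec] at g₁
  have g00 := congrFun g₀ 0
  have g10 := congrFun g₀ 1
  simp only [Matrix.mulVec, dotProduct, Fin.sum_univ_two, Matrix.cons_val_zero,
    Matrix.cons_val_one, mul_one, mul_zero, add_zero] at g00 g10
  -- An element of $U(1,1)$ fixing the first basis vector preserves its orthogonal complement, hence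
  -- is diagonal.
  have g01 : (K * k) 0 1 = 0 := by
    have h1 := hKU.herm_mulVec (k *ᵥ ![1, 0]) (k *ᵥ ![0, 1])
    rw [hk.herm_mulVec, Matrix.mulVec_mulVec, Matrix.mulVec_mulVec, g₀] at h1
    simp only [herm_fin_two, Matrix.mulVec, dotProduct, Fin.sum_univ_two, Matrix.cons_val_zero,
      Matrix.cons_val_one, mul_one, mul_zero, zero_add, zero_mul, map_zero, one_mul, add_zero,
      neg_zero, neg_eq_zero, map_eq_zero] at h1
    exact h1
  have hcomm := diagonal_commute_of_orbit g10 g01 g00 (exp_mul_conj_exp _) g₁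
  refine rel_iff_exists_commute.2 ⟨k, hk, rfl, ?_⟩
  set L := Complex.exp (θ₀ * Complex.I) • oneParam s t₀ with hL
  have hLg : L * gen s = gen s * L := by
    rw [hL, Matrix.smul_mul, oneParam_mul_gen, Matrix.mul_smul]
  calc k * gen s = L * (K * k * gen s) := by
        rw [← mul_assoc, ← mul_assoc, hKinv, one_mul]
    _ = gen s * k := by
        rw [hcomm, ← mul_assoc, hLg, mul_assoc, ← mul_assoc L, hKinv, one_mul]

theorem curveFamily_eq_iff {n : ℕ} (s : Kind) (u v : Stiefel n) :
    curveFamily s u = curveFamily s v ↔ (twistorSetoid n s).r u v :=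
  ⟨rel_of_curveFamily_eq, fun h => funext fun r => Set.Subset.antisymm
    (curveFamily_subset_of_rel ((twistorSetoid n s).symm h) r) (curveFamily_subset_of_rel h r)⟩

theorem exists_equiv_curveFamilies (n : ℕ) (s : Kind) :
    ∃ f : TwistorSpace n s ≃ curveFamilies n s,
      ∀ u : Stiefel n, (f (toTwistor s u)).1 = curveFamily s u := by
  let F : TwistorSpace n s → curveFamilies n s := Quotient.lift (s := twistorSetoid n s)
    (fun u => ⟨curveFamily s u, u, rfl⟩)
    (fun u v h => Subtype.ext ((curveFamily_eq_iff s u v).2 h))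
  refine ⟨Equiv.ofBijective F ⟨?_, ?_⟩, fun u => rfl⟩
  · rintro ⟨u⟩ ⟨v⟩ h
    exact Quotient.sound ((curveFamily_eq_iff s u v).1 (congrArg Subtype.val h))
  · rintro ⟨_, u, rfl⟩
    exact ⟨toTwistor s u, rfl⟩

end CHTwistor

theorem mainTheorem4 (n : ℕ) (hn : 2 ≤ n) (s : Kind) :
    (∃ e : TwistorSpace n s ≃ twistorBundle n s,
      ∀ u : Stiefel n, (e (toTwistor s u)).1 = ⟨plane u, frameStructure u s⟩) ∧
    (∃ f : TwistorSpace n s ≃ curveFamilies n s,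
      ∀ u : Stiefel n, (f (toTwistor s u)).1 = curveFamily s u) ∧
    (∀ u : Stiefel n,
      IsTotallyGeodesic (hyperbolicLine (plane u)) ∧
      (∀ r, curveFamily s u r ⊆ hyperbolicLine (plane u)) ∧
      IsParallelFamily (curve s u) ∧
      ∀ r, AdmissibleRadius s r → IsSmoothCurve (curve s u r) ∧
        ∃ κ, AdmissibleCurvature s κ ∧ ∀ t, HasCurvature (curve s u r) t κ) ∧
    (∀ (v : Stiefel n) (κ : ℝ), AdmissibleCurvature s κ → ∀ c : ℝ → CH n,
      IsSmoothCurve c → (∀ t, speedSq c t = 1) → (∀ t, c t ∈ hyperbolicLine (plane v)) →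
      (∀ t, HasCurvature c t κ) →
      ∃ (u : Stiefel n) (r a : ℝ), plane u = plane v ∧ AdmissibleRadius s r ∧ a ≠ 0 ∧
        ∀ t, c t = curve s u r (a * t)) := by
  refine ⟨exists_equiv_twistorBundle hn s, exists_equiv_curveFamilies n s, fun u =>
    ⟨isTotallyGeodesic_hyperbolicLine _, curveFamily_subset s u, isParallelFamily_curve s u,
      fun r hr => ⟨isSmoothCurve_curve s u r, _, admissibleCurvature_curve hr, fun t =>
        hasCurvature_curve s u r t hr⟩⟩, fun v κ hκ c hc hspeed hline hcurv =>
    exists_curve_of_hasCurvature v hκ hc hspeed hline hcurv⟩
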